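/- **Theorem (Finiteness Principles).** Let $X$ be a finite alphabet and $X^*$ the set of finite words over $X$. Let $G$ be a finitely generated group acting faithfully on $X^*$, and suppose that the action is * *selfsimilar*: for all $g\in G$, $x\in X$ there are $y\in X$, $h\in G$ with $g(xw)=y\,h(w)$ for all $w\in X^*$; then for every $g\in G$ and $v\in X^*$ there is a unique *restriction* $g|_v\in G$ with $g(vw)=g(v)\,g|_v(w)$ for all $w$; * *level-transitive*: transitive on the words of each given length; * *contracting*: there is a finite $N\subset G$ such that for every $g\in G$ one has $g|_v\in N$ for all sufficiently long words $v$; the smallest such $N$ is the *nucleus* $\mathcal N$; * *recurrent*: for each $x\in X$, the map $g\mapsto g|_x$ from the stabilizer of $x$ to $G$ is onto. Let $\mathcal S$ be a finite symmetric generating set of $G$ that is closed under restrictions and contains $\mathcal N$. The *selfsimilarity complex* $\Sigma$ is the 1-complex with 0-cells $X^*$, a vertical 1-cell from $w$ to $xw$ for all $w\in X^*$, $x\in X$, and a horizontal 1-cell from $w$ to $s(w)$ for all $w\in X^*$, $s\in\mathcal S$, with the length metric $|a-b|$ in which each 1-cell has length $1$. The level $|w|$ of a vertex $w$ is its length. Let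 $F\colon\Sigma-\{\text{level zero}\}\to\Sigma$ be the cellular map that deletes the last letter of each word and preserves the labels $x$, $s$ of the 1-cells. For a set $V$ of vertices, $\Sigma(V)$ is the induced subcomplex; the *shadow* is $S(V)=\Sigma(\{wv : v\in V,\ w\in X^*\})$; the *umbra* $U(V)$ is the subcomplex induced on the vertices of $S(V)$ whose distance from every vertex outside $S(V)$ is greater than $1$. For a vertex $v$ and an integer $r>0$ let $B_{hor}(v,r)=\{w\in X^* : |w|=|v|,\ |v-w|\le r\}$ and $S(v,r)=S(B_{hor}(v,r))$. Two maps $f_i\colon \widetilde Z_i\to Z_i$ ($i=1,2$) between subcomplexes of $\Sigma$, with the distance of $\Sigma$, have the same *isometry type* if there are bijective isometries $\widetilde\phi\colon\widetilde Z_1\to\widetilde Z_2$ and $\phi\colon Z_1\to Z_2$, which are also cellular isomorphisms, with $\phi\circ f_1=f_2\circ\widetilde\phi$. Fix an integer $r>0$. Then there is a level $n=n(r)$ such that, as $v$ ranges over all vertices with $|v|>n(r)$, $k$ over all integers $k\ge 0$, and $\widetilde S$ over all connected components of $F^{-k}(S)$, where $S=S(v,r)$, there are only finitely many isometry types of maps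 $$F^k\colon \widetilde S\to S,$$ and only finitely many isometry types of maps $$F^k\colon \widetilde U\to U,$$ where $U=U(B_{hor}(v,r))$ and $\widetilde U=U(\widetilde V)$, with $\widetilde V=F^{-k}(B_{hor}(v,r))\cap\widetilde S$, are the corresponding umbrae. -/

import Mathlib

set_option linter.unusedSectionVars false

namespace SelfSim

universe u v

/-! ### Selfsimilar actions on the set `X*` of finite words (`List X`) -/

section Actions

variable (G : Type u) (X : Type v) [Group G] [MulAction G (List X)]

/-- The action is selfsimilar: for all `g` and all letters `x` there are a letter `y` and `h ∈ G`
with `g(xw) = y h(w)` for every word `w`. -/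
def IsSelfSimilar : Prop :=
  ∀ (g : G) (x : X), ∃ (y : X) (h : G), ∀ w : List X, g • (x :: w) = y :: (h • w)

variable {G X}

/-- `h` is the restriction `g|_v`, i.e. `g(vw) = g(v) h(w)` for every word `w`.  For a faithful
selfsimilar action there is exactly one such `h`. -/
def IsRestriction (g : G) (v : List X) (h : G) : Prop :=
  ∀ w : List X, g • (v ++ w) = g • v ++ h • w

variable (G X)

/-- The action is transitive on each level `X^n`. -/
def IsLevelTransitive : Prop :=
  ∀ a b : List X, a.length = b.length → ∃ g : G, g • a = b

/-- The action is recurrent: for each letter `x`, the map `g ↦ g|_x` from the stabilizer of `x`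
to `G` is onto. -/
def IsRecurrent : Prop :=
  ∀ (x : X) (h : G), ∃ g : G, g • [x] = [x] ∧ IsRestriction g [x] h

variable {G}

/-- Every `g ∈ G` has all its restrictions to sufficiently long words in `N`. -/
def Attracts (N : Set G) : Prop :=
  ∀ g : G, ∃ n : ℕ, ∀ v : List X, n ≤ v.length → ∀ h : G, IsRestriction g v h → h ∈ N

variable (G)

/-- The action is contracting. -/
def IsContracting : Prop := ∃ N : Set G, N.Finite ∧ Attracts X N

/-- The nucleus: the smallest finite set that attracts all restrictions to long words. -/
def nucleus : Set G := ⋂₀ {N : Set G | N.Finite ∧ Attracts X N}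

variable {G}

/-- `S` is closed under restrictions. -/
def RestrictionClosed (S : Set G) : Prop :=
  ∀ s ∈ S, ∀ (v : List X) (h : G), IsRestriction s v h → h ∈ S

end Actions

/-! ### The selfsimilarity complex -/

section Complex

variable {G : Type u} (X : Type v)

/-- The 1-cells of the selfsimilarity complex: for every word `w` and every `s ∈ S` a horizontal
1-cell from `w` to `s(w)` labelled `s`, and for every letter `x` a vertical 1-cell from `w` to
`xw` labelled `x`.  The 0-cells are the words. -/
inductive Cell (S : Set G) : Type (max u v)
  | horiz (w : List X) (s : S)
  | vert (w : List X) (x : X)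

/-- The points of the selfsimilarity complex: 0-cells, and interior points of 1-cells (each
1-cell being parametrized by `[0, 1]` from its source to its target). -/
inductive Point (S : Set G) : Type (max u v)
  | vertex (w : List X)
  | interior (e : Cell X S) (t : Set.Ioo (0 : ℝ) 1)

variable {X} [Group G] [MulAction G (List X)] {S : Set G}

/-- Initial vertex of a 1-cell. -/
def Cell.src : Cell X S → List X
  | .horiz w _ => w
  | .vert w _ => w

/-- Terminal vertex of a 1-cell. -/
def Cell.tgt : Cell X S → List X
  | .horiz w s => (s : G) • w
  | .vert w x => x :: w

variable (X S)

/-- The graph on the words in which two distinct words are adjacent when a 1-cell joins them.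
Its distance function is the distance between vertices in the selfsimilarity complex. -/
def skeleton : SimpleGraph (List X) :=
  SimpleGraph.fromRel fun a b => ∃ e : Cell X S, e.src = a ∧ e.tgt = b

theorem skeleton_connected : (skeleton X S).Connected := by
  have key : ∀ w : List X, (skeleton X S).Reachable w [] := by
    intro w
    induction w with
    | nil => exact SimpleGraph.Reachable.refl _
    | cons x w ih =>
      refine SimpleGraph.Reachable.trans (SimpleGraph.Adj.reachable ?_) ih
      rw [skeleton, SimpleGraph.fromRel_adj]
      exact ⟨by simp, Or.inr ⟨Cell.vert w x, rfl, rfl⟩⟩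
  exact ⟨fun a b => (key a).trans (key b).symm⟩

/-- Distance between two vertices. -/
noncomputable def vdist (a b : List X) : ℝ := ((skeleton X S).dist a b : ℝ)

variable {X S}

theorem vdist_self (a : List X) : vdist X S a a = 0 := by simp [vdist]

theorem vdist_comm (a b : List X) : vdist X S a b = vdist X S b a := by
  simp [vdist, SimpleGraph.dist_comm]

theorem vdist_nonneg (a b : List X) : 0 ≤ vdist X S a b := by simp [vdist]

theorem vdist_triangle (a b c : List X) : vdist X S a c ≤ vdist X S a b + vdist X S b c := by
  unfold vdist
  exact_mod_cast (skeleton_connected X S).dist_triangle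

theorem vdist_eq_zero {a b : List X} (h : vdist X S a b = 0) : a = b := by
  unfold vdist at h
  exact (skeleton_connected X S).dist_eq_zero_iff.1 (by exact_mod_cast h)

theorem vdist_src_tgt (e : Cell X S) : vdist X S e.src e.tgt ≤ 1 := by
  by_cases h : e.src = e.tgt
  · rw [h, vdist_self]; norm_num
  · have hadj : (skeleton X S).Adj e.src e.tgt := by
      rw [skeleton, SimpleGraph.fromRel_adj]
      exact ⟨h, Or.inl ⟨e, rfl, rfl⟩⟩
    unfold vdist
    rw [SimpleGraph.dist_eq_one_iff_adj.2 hadj]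
    norm_num

/-- Distance from a point to a vertex. -/
noncomputable def Point.toVertex : Point X S → List X → ℝ
  | .vertex w, a => vdist X S w a
  | .interior e t, a => min (t + vdist X S e.src a) (1 - t + vdist X S e.tgt a)

/-- Infimum of the lengths of the paths between two points that pass through some vertex (an
endpoint of the 1-cell of the first point, if that point is not a vertex). -/
noncomputable def Point.through : Point X S → Point X S → ℝ
  | .vertex w, q => q.toVertex w
  | .interior e t, q => min (t + q.toVertex e.src) (1 - t + q.toVertex e.tgt)

open Classical in
/-- The length metric in which each 1-cell is a unit interval: two points of the same open 1-cell
may also be joined inside this cell. -/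
noncomputable def Point.pointDist : Point X S → Point X S → ℝ
  | .interior e t, .interior e' t' =>
      if e = e' then min |(t : ℝ) - t'| (Point.through (.interior e t) (.interior e' t'))
      else Point.through (.interior e t) (.interior e' t')
  | p, q => p.through q

theorem toVertex_nonneg (p : Point X S) (a : List X) : 0 ≤ p.toVertex a := by
  cases p with
  | vertex w => exact vdist_nonneg _ _
  | interior e t =>
    have h0 := t.2.1
    have h1 := t.2.2
    have := vdist_nonneg (S := S) e.src a
    have := vdist_nonneg (S := S) e.tgt a
    exact le_min (by linarith) (by linarith)

theorem toVertex_pos (e : Cell X S) (t : Set.Ioo (0 : ℝ) 1) (a : List X) :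
    0 < (Point.interior e t).toVertex a := by
  have h0 := t.2.1
  have h1 := t.2.2
  have := vdist_nonneg (S := S) e.src a
  have := vdist_nonneg (S := S) e.tgt a
  exact lt_min (by linarith) (by linarith)

theorem toVertex_triangle (p : Point X S) (a b : List X) :
    p.toVertex a ≤ p.toVertex b + vdist X S b a := by
  cases p with
  | vertex w => exact vdist_triangle _ _ _
  | interior e t =>
    simp only [Point.toVertex]
    have h1 := vdist_triangle (S := S) e.src b a
    have h2 := vdist_triangle (S := S) e.tgt b a
    rw [← min_add_add_right]
    exact min_le_min (by linarith) (by linarith)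

theorem vdist_le_toVertex (p : Point X S) (a b : List X) :
    vdist X S a b ≤ p.toVertex a + p.toVertex b := by
  cases p with
  | vertex w =>
    have := vdist_triangle (S := S) a w b
    rw [vdist_comm a w] at this
    exact this
  | interior e t =>
    simp only [Point.toVertex]
    have h0 := t.2.1
    have h1 := t.2.2
    have a1 := vdist_triangle (S := S) a e.src b
    have a2 := vdist_triangle (S := S) a e.tgt b
    have a3 := vdist_triangle (S := S) a e.src e.tgt
    have a4 := vdist_triangle (S := S) b e.src e.tgt
    have a5 := vdist_src_tgt e
    rw [vdist_comm a e.src] at a1 a3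
    rw [vdist_comm a e.tgt] at a2 a3
    rw [vdist_comm b e.tgt, vdist_comm b e.src] at a4
    have a6 := vdist_triangle (S := S) a e.tgt b
    have a7 := vdist_triangle (S := S) e.src e.tgt b
    have a8 := vdist_triangle (S := S) e.tgt e.src b
    rw [vdist_comm a e.tgt] at a6
    rw [vdist_comm e.tgt e.src] at a8
    rcases min_cases (t + vdist X S e.src a) (1 - t + vdist X S e.tgt a) with ⟨h, _⟩ | ⟨h, _⟩ <;>
    rcases min_cases (t + vdist X S e.src b) (1 - t + vdist X S e.tgt b) with ⟨h', _⟩ | ⟨h', _⟩ <;>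
    rw [h, h'] <;> linarith

theorem through_le (p q : Point X S) (a : List X) :
    p.through q ≤ p.toVertex a + q.toVertex a := by
  cases p with
  | vertex w =>
    have := toVertex_triangle q w a
    rw [vdist_comm] at this
    change q.toVertex w ≤ vdist X S w a + q.toVertex a
    linarith
  | interior e t =>
    simp only [Point.through]
    have h1 := toVertex_triangle q e.src a
    have h2 := toVertex_triangle q e.tgt a
    rw [vdist_comm] at h1 h2
    rw [show (Point.interior e t).toVertex a =
      min (t + vdist X S e.src a) (1 - t + vdist X S e.tgt a) from rfl, ← min_add_add_right]
    exact min_le_min (by linarith) (by linarith)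

theorem exists_through (p q : Point X S) :
    ∃ a : List X, p.through q = p.toVertex a + q.toVertex a := by
  cases p with
  | vertex w => exact ⟨w, by simp [Point.through, Point.toVertex, vdist_self]⟩
  | interior e t =>
    rcases min_cases (t + q.toVertex e.src) (1 - t + q.toVertex e.tgt) with ⟨h, _⟩ | ⟨h, _⟩
    · refine ⟨e.src, le_antisymm (through_le _ _ _) ?_⟩
      have : (Point.interior e t).toVertex e.src ≤ t := by
        refine (min_le_left _ _).trans ?_
        rw [vdist_self]; simp
      simp only [Point.through]
      linarith
    · refine ⟨e.tgt, le_antisymm (through_le _ _ _) ?_⟩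
      have : (Point.interior e t).toVertex e.tgt ≤ 1 - t := by
        refine (min_le_right _ _).trans ?_
        rw [vdist_self]; simp
      simp only [Point.through]
      linarith

theorem through_comm (p q : Point X S) : p.through q = q.through p := by
  apply le_antisymm
  · obtain ⟨a, ha⟩ := exists_through q p
    rw [ha, add_comm]; exact through_le _ _ _
  · obtain ⟨a, ha⟩ := exists_through p q
    rw [ha, add_comm]; exact through_le _ _ _

theorem through_triangle (p q r : Point X S) :
    p.through r ≤ p.through q + q.through r := by
  obtain ⟨a, ha⟩ := exists_through p q
  obtain ⟨b, hb⟩ := exists_through q r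
  have h1 := through_le p r a
  have h2 := vdist_le_toVertex q a b
  have h3 := toVertex_triangle r a b
  rw [vdist_comm] at h3
  linarith

theorem toVertex_same_cell (e : Cell X S) (t t' : Set.Ioo (0 : ℝ) 1) (a : List X) :
    (Point.interior e t).toVertex a ≤ |(t : ℝ) - t'| + (Point.interior e t').toVertex a := by
  simp only [Point.toVertex]
  rw [← min_add_add_left]
  have h1 := le_abs_self ((t : ℝ) - t')
  have h2 := neg_abs_le ((t : ℝ) - t')
  exact min_le_min (by linarith) (by linarith)

theorem through_same_cell (e : Cell X S) (t t' : Set.Ioo (0 : ℝ) 1) (r : Point X S) :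
    (Point.interior e t).through r ≤ |(t : ℝ) - t'| + (Point.interior e t').through r := by
  obtain ⟨a, ha⟩ := exists_through (Point.interior e t') r
  have h1 := through_le (Point.interior e t) r a
  have h2 := toVertex_same_cell e t t' a
  linarith

theorem pointDist_le_through (p q : Point X S) : p.pointDist q ≤ p.through q := by
  cases p <;> cases q <;> simp only [Point.pointDist] <;> try exact le_rfl
  split_ifs
  · exact min_le_right _ _
  · exact le_rfl

theorem pointDist_same_cell (e : Cell X S) (t t' : Set.Ioo (0 : ℝ) 1) :
    (Point.interior e t).pointDist (Point.interior e t') ≤ |(t : ℝ) - t'| := by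
  simp only [Point.pointDist, if_true]
  exact min_le_left _ _

theorem pointDist_cases (p q : Point X S) : p.pointDist q = p.through q ∨
    ∃ e t t', p = Point.interior e t ∧ q = Point.interior e t' ∧
      p.pointDist q = |(t : ℝ) - t'| := by
  cases p with
  | vertex w => exact Or.inl rfl
  | interior e t =>
    cases q with
    | vertex w => exact Or.inl rfl
    | interior e' t' =>
      simp only [Point.pointDist]
      by_cases h : e = e'
      · subst h
        simp only [if_true]
        rcases min_choice |(t : ℝ) - t'| ((Point.interior e t).through (.interior e t')) with h | h
        · exact Or.inr ⟨e, t, t', rfl, rfl, h⟩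
        · exact Or.inl h
      · exact Or.inl (if_neg h)

/-- The selfsimilarity complex as a metric space. -/
noncomputable instance : MetricSpace (Point X S) where
  dist := Point.pointDist
  dist_self p := by
    cases p with
    | vertex w => exact vdist_self w
    | interior e t =>
      apply le_antisymm
      · simpa using pointDist_same_cell e t t
      · rcases pointDist_cases (Point.interior e t) (Point.interior e t) with h | ⟨_, _, _, _, _, h⟩
        · obtain ⟨a, ha⟩ := exists_through (Point.interior e t) (Point.interior e t)
          rw [h, ha]
          exact add_nonneg (toVertex_nonneg _ _) (toVertex_nonneg _ _)
        · rw [h]; exact abs_nonneg _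
  dist_comm p q := by
    cases p with
    | vertex w =>
      cases q with
      | vertex w' => exact through_comm (Point.vertex w) (Point.vertex w')
      | interior e' t' => exact through_comm (Point.vertex w) (Point.interior e' t')
    | interior e t =>
      cases q with
      | vertex w => exact through_comm (Point.interior e t) (Point.vertex w)
      | interior e' t' =>
        simp only [Point.pointDist]
        rw [through_comm (Point.interior e t), abs_sub_comm]
        by_cases h : e = e'
        · rw [if_pos h, if_pos h.symm]
        · rw [if_neg h, if_neg (Ne.symm h)]
  dist_triangle p q r := by
    rcases pointDist_cases p q with h1 | ⟨e, t, t', rfl, rfl, h1⟩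
    · rcases pointDist_cases q r with h2 | ⟨e, t, t', rfl, rfl, h2⟩
      · rw [h1, h2]
        exact (pointDist_le_through _ _).trans (through_triangle _ _ _)
      · rw [h1, h2]
        refine (pointDist_le_through _ _).trans ?_
        rw [through_comm p, through_comm p, add_comm, abs_sub_comm]
        exact through_same_cell _ _ _ _
    · rcases pointDist_cases (Point.interior e t') r with h2 | ⟨e', s, s', h3, rfl, h2⟩
      · rw [h1, h2]
        exact (pointDist_le_through _ _).trans (through_same_cell _ _ _ _)
      · rw [h1, h2]
        obtain ⟨rfl, rfl⟩ := Point.interior.inj h3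
        exact (pointDist_same_cell _ _ _).trans (abs_sub_le _ _ _)
  eq_of_dist_eq_zero {p q} h := by
    change p.pointDist q = 0 at h
    rcases pointDist_cases p q with h1 | ⟨e, t, t', rfl, rfl, h1⟩
    · obtain ⟨a, ha⟩ := exists_through p q
      rw [h1, ha] at h
      have hp := toVertex_nonneg p a
      have hq := toVertex_nonneg q a
      have hp0 : p.toVertex a = 0 := by linarith
      have hq0 : q.toVertex a = 0 := by linarith
      cases p with
      | interior e t => exact absurd hp0 (toVertex_pos e t a).ne'
      | vertex w =>
        cases q with
        | interior e t => exact absurd hq0 (toVertex_pos e t a).ne'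
        | vertex w' => rw [vdist_eq_zero hp0, vdist_eq_zero hq0]
    · rw [h1] at h
      have : t = t' := Subtype.ext (sub_eq_zero.1 (abs_eq_zero.1 h))
      rw [this]

/-- The induced subcomplex on a set `V` of vertices: its 1-cells are all the 1-cells with both
endpoints in `V`. -/
def induced (V : Set (List X)) : Set (Point X S) :=
  {p | match p with
    | .vertex w => w ∈ V
    | .interior e _ => e.src ∈ V ∧ e.tgt ∈ V}

/-- The vertex sets of the connected components of the induced subcomplex on `A`.  (Such a
component is itself the induced subcomplex on its vertex set.) -/
def IsComponent (S : Set G) (A C : Set (List X)) : Prop :=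
  ∃ c : ((skeleton X S).induce A).ConnectedComponent, C = Subtype.val '' c.supp

/-- The horizontal ball `B_hor(v, r)`: the vertices at the level of `v` and at distance at most
`r` from `v`. -/
def horBall (S : Set G) (v : List X) (r : ℕ) : Set (List X) :=
  {w | w.length = v.length ∧ (skeleton X S).dist v w ≤ r}

/-- The cone `{wv : w ∈ X*}` of a vertex `v`. -/
def cone (v : List X) : Set (List X) := {u | ∃ w : List X, u = w ++ v}

/-- The vertices of the shadow `S(V)`; the shadow is the subcomplex induced on them. -/
def shadow (V : Set (List X)) : Set (List X) := ⋃ v ∈ V, cone v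

/-- The vertices of the umbra `U(V)`: those vertices of the shadow whose distance from every
vertex outside of the shadow exceeds `1`.  The umbra is the subcomplex induced on them. -/
def umbra (S : Set G) (V : Set (List X)) : Set (List X) :=
  {u | u ∈ shadow V ∧ ∀ y, y ∉ shadow V → 1 < (skeleton X S).dist u y}

/-! ### The induced dynamics -/

/-- The shift on 1-cells; it preserves the labels. -/
def Cell.shift : Cell X S → Cell X S
  | .horiz w s => .horiz w.dropLast s
  | .vert w x => .vert w.dropLast x

/-- The map `F`: the right shift, deleting the last letter, on vertices, and the label preserving
map on 1-cells.  It is meaningful off level zero only; the `k`-th iterate is used only on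
subcomplexes all of whose vertices have level at least `k`. -/
def Point.F : Point X S → Point X S
  | .vertex w => .vertex w.dropLast
  | .interior e t => .interior e.shift t

/-- The vertices of `F^{-k}(Σ(A))`, which is the subcomplex induced on them. -/
def pullback (k : ℕ) (A : Set (List X)) : Set (List X) :=
  {u | k ≤ u.length ∧ List.dropLast^[k] u ∈ A}

/-- A map between two subcomplexes (with the distance of the ambient complex). -/
structure SubcomplexMap (X : Type v) (S : Set G) where
  source : Set (Point X S)
  target : Set (Point X S)
  toFun : source → target

/-- A bijection between subcomplexes that takes exactly the 0-cells to 0-cells.  (If it is an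
isometry, then it takes open 1-cells onto open 1-cells as well.) -/
def IsCellular {A B : Set (Point X S)} (φ : A → B) : Prop :=
  ∀ p : A, (∃ w, (p : Point X S) = .vertex w) ↔ ∃ w, (φ p : Point X S) = .vertex w

/-- Two maps are isometrically isomorphic: there are isometries between the sources and between
the targets, which are cellular isomorphisms and commute with the maps. -/
def IsometricallyIsomorphic (f g : SubcomplexMap X S) : Prop :=
  ∃ (ψ : f.source ≃ᵢ g.source) (φ : f.target ≃ᵢ g.target),
    IsCellular ψ ∧ IsCellular φ ∧ ∀ p, φ (f.toFun p) = g.toFun (ψ p)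

instance isometrySetoid (X : Type v) [MulAction G (List X)] (S : Set G) :
    Setoid (SubcomplexMap X S) where
  r := IsometricallyIsomorphic
  iseqv :=
    { refl := fun f => ⟨IsometryEquiv.refl _, IsometryEquiv.refl _, fun _ => Iff.rfl,
        fun _ => Iff.rfl, fun _ => rfl⟩
      symm := by
        rintro f g ⟨ψ, φ, hψ, hφ, h⟩
        refine ⟨ψ.symm, φ.symm, fun p => ?_, fun p => ?_, fun p => ?_⟩
        · simpa using (hψ (ψ.symm p)).symm
        · simpa using (hφ (φ.symm p)).symm
        · rw [IsometryEquiv.symm_apply_eq, h, IsometryEquiv.apply_symm_apply]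
      trans := by
        rintro f g k ⟨ψ, φ, hψ, hφ, h⟩ ⟨ψ', φ', hψ', hφ', h'⟩
        refine ⟨ψ.trans ψ', φ.trans φ', fun p => (hψ p).trans (hψ' _),
          fun p => (hφ p).trans (hφ' _), fun p => ?_⟩
        simp only [IsometryEquiv.trans_apply]
        rw [h, h'] }

/-- The isometry type of a map. -/
def isometryType (f : SubcomplexMap X S) : Quotient (isometrySetoid X S) :=
  Quotient.mk (isometrySetoid X S) f

/-- A vertex `v` of level greater than `n`, an iterate `k` and a connected component of
`F^{-k}(S(v, r))`, given by its vertex set. -/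
structure ShadowPullback (X : Type v) [MulAction G (List X)] (S : Set G) (r n : ℕ) where
  v : List X
  level : n < v.length
  k : ℕ
  comp : Set (List X)
  isComponent : IsComponent S (pullback k (shadow (horBall S v r))) comp

/-! ### `F^k` maps `S̃` into `S` and `Ũ` into `U` -/

theorem smul_nil (hG : IsSelfSimilar G X) (g : G) : g • ([] : List X) = [] := by
  rcases h : g⁻¹ • ([] : List X) with _ | ⟨x, w⟩
  · rw [inv_smul_eq_iff] at h; exact h.symm
  · obtain ⟨y, h', hw⟩ := hG g x
    have := hw w
    rw [← h, smul_inv_smul] at this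
    exact absurd this (by simp)

theorem length_smul (hG : IsSelfSimilar G X) (g : G) (w : List X) :
    (g • w).length = w.length := by
  induction w generalizing g with
  | nil => rw [smul_nil hG]
  | cons x w ih =>
    obtain ⟨y, h, hw⟩ := hG g x
    rw [hw, List.length_cons, List.length_cons, ih]

theorem dropLast_smul (hG : IsSelfSimilar G X) (g : G) (w : List X) :
    (g • w).dropLast = g • w.dropLast := by
  induction w generalizing g with
  | nil => simp [smul_nil hG]
  | cons x w ih =>
    obtain ⟨y, h, hw⟩ := hG g x
    rcases w with _ | ⟨x', w⟩
    · rw [hw, smul_nil hG]; simp [smul_nil hG]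
    · have hne : h • (x' :: w) ≠ [] := by
        intro h0
        have := length_smul hG h (x' :: w)
        rw [h0] at this
        simp at this
      rw [hw, List.dropLast_cons_of_ne_nil hne, List.dropLast_cons_of_ne_nil (by simp), hw, ih]

theorem iterate_dropLast_smul (hG : IsSelfSimilar G X) (g : G) (k : ℕ) (w : List X) :
    List.dropLast^[k] (g • w) = g • List.dropLast^[k] w := by
  induction k generalizing w with
  | zero => rfl
  | succ k ih => rw [Function.iterate_succ_apply, Function.iterate_succ_apply, dropLast_smul hG, ih]

theorem iterate_dropLast_append (k : ℕ) (w u : List X) (hu : k ≤ u.length) :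
    List.dropLast^[k] (w ++ u) = w ++ List.dropLast^[k] u := by
  induction k generalizing u with
  | zero => rfl
  | succ k ih =>
    have hne : u ≠ [] := by rintro rfl; simp at hu
    rw [Function.iterate_succ_apply, Function.iterate_succ_apply,
      List.dropLast_append_of_ne_nil hne, ih _ (by rw [List.length_dropLast]; omega)]

theorem iterate_src (k : ℕ) (e : Cell X S) :
    (Cell.shift^[k] e).src = List.dropLast^[k] e.src := by
  induction k generalizing e with
  | zero => rfl
  | succ k ih =>
    rw [Function.iterate_succ_apply, Function.iterate_succ_apply, ih]
    cases e <;> rfl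

theorem iterate_tgt (hG : IsSelfSimilar G X) (k : ℕ) (e : Cell X S) (he : k ≤ e.src.length) :
    (Cell.shift^[k] e).tgt = List.dropLast^[k] e.tgt := by
  induction k generalizing e with
  | zero => rfl
  | succ k ih =>
    rw [Function.iterate_succ_apply, Function.iterate_succ_apply]
    cases e with
    | horiz w s =>
      rw [ih _ (by simp only [Cell.shift, Cell.src, List.length_dropLast] at he ⊢; omega)]
      simp only [Cell.shift, Cell.tgt, dropLast_smul hG]
    | vert w x =>
      rw [ih _ (by simp only [Cell.shift, Cell.src, List.length_dropLast] at he ⊢; omega)]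
      have hne : w ≠ [] := by rintro rfl; simp [Cell.src] at he
      simp only [Cell.shift, Cell.tgt, List.dropLast_cons_of_ne_nil hne]

theorem iterate_F_vertex (k : ℕ) (w : List X) :
    Point.F^[k] (.vertex w : Point X S) = .vertex (List.dropLast^[k] w) := by
  induction k generalizing w with
  | zero => rfl
  | succ k ih => rw [Function.iterate_succ_apply, Function.iterate_succ_apply, Point.F, ih]

theorem iterate_F_interior (k : ℕ) (e : Cell X S) (t : Set.Ioo (0 : ℝ) 1) :
    Point.F^[k] (.interior e t : Point X S) = .interior (Cell.shift^[k] e) t := by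
  induction k generalizing e with
  | zero => rfl
  | succ k ih => rw [Function.iterate_succ_apply, Function.iterate_succ_apply, Point.F, ih]

theorem mapsTo_induced (hG : IsSelfSimilar G X) (k : ℕ) {A B : Set (List X)}
    (h : ∀ u ∈ A, k ≤ u.length ∧ List.dropLast^[k] u ∈ B) :
    Set.MapsTo (Point.F^[k]) (induced A : Set (Point X S)) (induced B) := by
  rintro (w | ⟨e, t⟩) hp
  · rw [iterate_F_vertex]
    exact (h w hp).2
  · obtain ⟨h1, h2⟩ := hp
    rw [iterate_F_interior]
    refine ⟨?_, ?_⟩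
    · rw [iterate_src]; exact (h _ h1).2
    · rw [iterate_tgt hG k e (h _ h1).1]; exact (h _ h2).2

theorem IsComponent.subset {A C : Set (List X)} (h : IsComponent S A C) : C ⊆ A := by
  obtain ⟨c, rfl⟩ := h
  rintro _ ⟨u, _, rfl⟩
  exact u.2

theorem adj_lift (hG : IsSelfSimilar G X) (k : ℕ) {u y : List X} (hu : k ≤ u.length)
    (hadj : (skeleton X S).Adj (List.dropLast^[k] u) y) :
    ∃ y', (skeleton X S).Adj u y' ∧ List.dropLast^[k] y' = y := by
  rw [skeleton, SimpleGraph.fromRel_adj] at hadj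
  obtain ⟨hne, ⟨e, he1, he2⟩ | ⟨e, he1, he2⟩⟩ := hadj
  · cases e with
    | horiz w s =>
      simp only [Cell.src, Cell.tgt] at he1 he2
      have hy : List.dropLast^[k] ((s : G) • u) = y := by
        rw [iterate_dropLast_smul hG, ← he1, he2]
      refine ⟨(s : G) • u, ?_, hy⟩
      rw [skeleton, SimpleGraph.fromRel_adj]
      exact ⟨fun h => hne (by rw [h]; exact hy), Or.inl ⟨.horiz u s, rfl, rfl⟩⟩
    | vert w x =>
      simp only [Cell.src, Cell.tgt] at he1 he2
      refine ⟨x :: u, ?_, ?_⟩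
      · rw [skeleton, SimpleGraph.fromRel_adj]
        exact ⟨by simp, Or.inl ⟨.vert u x, rfl, rfl⟩⟩
      · have := iterate_dropLast_append k [x] u hu
        simpa [← he2, he1] using this
  · cases e with
    | horiz w s =>
      simp only [Cell.src, Cell.tgt] at he1 he2
      have hy : List.dropLast^[k] ((s : G)⁻¹ • u) = y := by
        rw [iterate_dropLast_smul hG, ← he2, he1, inv_smul_smul]
      refine ⟨(s : G)⁻¹ • u, ?_, hy⟩
      rw [skeleton, SimpleGraph.fromRel_adj]
      exact ⟨fun h => hne (by rw [h]; exact hy),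
        Or.inr ⟨.horiz ((s : G)⁻¹ • u) s, rfl, by simp [Cell.tgt]⟩⟩
    | vert w x =>
      simp only [Cell.src, Cell.tgt] at he1 he2
      rcases u with _ | ⟨x', u'⟩
      · have hk : k = 0 := by simpa using hu
        subst hk
        simp at he2
      · have hk : k ≤ u'.length := by
          by_contra hcon
          have hk : k = (x' :: u').length := by simp only [List.length_cons] at hu ⊢; omega
          have hlen : ∀ (j : ℕ) (z : List X), (List.dropLast^[j] z).length = z.length - j := by
            intro j
            induction j with
            | zero => intro z; rfl
            | succ j ih =>
              intro z
              rw [Function.iterate_succ_apply, ih, List.length_dropLast]; omega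
          have := hlen k (x' :: u')
          rw [← he2, hk] at this
          simp at this
        have h1 := iterate_dropLast_append k [x'] u' hk
        simp only [List.singleton_append] at h1
        rw [h1] at he2
        obtain ⟨_, h2⟩ := List.cons.inj he2
        refine ⟨u', ?_, by rw [← h2, he1]⟩
        rw [skeleton, SimpleGraph.fromRel_adj]
        exact ⟨by simp, Or.inr ⟨.vert u' x', rfl, rfl⟩⟩

variable {r n : ℕ}

/-- The vertex set `V = B_hor(v, r)` that defines the shadow `S = S(V)`. -/
def ShadowPullback.base (P : ShadowPullback X S r n) : Set (List X) := horBall S P.v r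

/-- The vertex set `Ṽ = F^{-k}(V) ∩ S̃`, for which `S̃ = S(Ṽ)`. -/
def ShadowPullback.liftedBase (P : ShadowPullback X S r n) : Set (List X) :=
  pullback P.k P.base ∩ P.comp

theorem ShadowPullback.mapsTo_shadow (hG : IsSelfSimilar G X) (P : ShadowPullback X S r n) :
    Set.MapsTo (Point.F^[P.k]) (induced P.comp : Set (Point X S)) (induced (shadow P.base)) :=
  mapsTo_induced hG P.k fun _ hu => P.isComponent.subset hu

theorem ShadowPullback.mapsTo_umbra (hG : IsSelfSimilar G X) (P : ShadowPullback X S r n) :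
    Set.MapsTo (Point.F^[P.k]) (induced (umbra S P.liftedBase) : Set (Point X S))
      (induced (umbra S P.base)) := by
  have key : ∀ u ∈ shadow P.liftedBase,
      P.k ≤ u.length ∧ List.dropLast^[P.k] u ∈ shadow P.base := by
    intro u hu
    simp only [shadow, Set.mem_iUnion] at hu
    obtain ⟨b, hb, w, rfl⟩ := hu
    refine ⟨by rw [List.length_append]; exact hb.1.1.trans (Nat.le_add_left _ _), ?_⟩
    rw [iterate_dropLast_append _ _ _ hb.1.1]
    simp only [shadow, Set.mem_iUnion]
    exact ⟨_, hb.1.2, w, rfl⟩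
  refine mapsTo_induced hG P.k fun u hu => ⟨(key u hu.1).1, (key u hu.1).2, fun y hy => ?_⟩
  by_contra hcon
  have hne : List.dropLast^[P.k] u ≠ y := fun h => hy (h ▸ (key u hu.1).2)
  have hpos := (skeleton_connected X S).pos_dist_of_ne hne
  have hadj : (skeleton X S).Adj (List.dropLast^[P.k] u) y :=
    SimpleGraph.dist_eq_one_iff_adj.1 (by omega)
  obtain ⟨y', h1, h2⟩ := adj_lift hG P.k (key u hu.1).1 hadj
  have hy' : y' ∉ shadow P.liftedBase := fun h => hy (h2 ▸ (key y' h).2)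
  have := hu.2 y' hy'
  rw [SimpleGraph.dist_eq_one_iff_adj.2 h1] at this
  omega

/-- The map `F^k : S̃ → S`. -/
def ShadowPullback.shadowMap (hG : IsSelfSimilar G X) (P : ShadowPullback X S r n) :
    SubcomplexMap X S :=
  ⟨induced P.comp, induced (shadow P.base), (P.mapsTo_shadow hG).restrict⟩

/-- The map `F^k : Ũ → U`, where `Ũ = U(Ṽ)` and `U = U(V)`. -/
def ShadowPullback.umbraMap (hG : IsSelfSimilar G X) (P : ShadowPullback X S r n) :
    SubcomplexMap X S :=
  ⟨induced (umbra S P.liftedBase), induced (umbra S P.base), (P.mapsTo_umbra hG).restrict⟩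

end Complex

end SelfSim

/-! Reaching one vertex from another takes three kinds of moves: deleting front letters, acting by
the group, and adding front letters. Passing to restrictions does not lengthen a group element, so
any path can be rearranged, without getting longer, into deletions, then one group element, then
insertions. Contraction bounds the length of the middle element on a geodesic: were it long,
descending `L` more letters on both sides would shorten it by more than the detour costs. Hence
there is a constant `C` such that every distance is realized by a middle element of length at most
`C` (`exists_bounded_normal_form`).

Consequently the shadow of a set `V` lying in one level is determined, with its distances and
labels, by finite data on `V`: the distances in `V` and the partial action of the ball of radius `C`
(`BaseIso.vertexIso`). A geodesic between points of the shadow either stays above `V`, where only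
restrictions of the middle element reach `V`, or dips below `V`, where its length splits through a
distance in `V`. The umbra is cut out by adjacency, so it is carried along.

A component of the pullback of a shadow is itself the shadow of its bottom level. What remains is to
bound the size and the diameter of that level independently of `v` and `k`
(`IsComponent.base_bounded`). Above level `n` every group element that matters restricts into `S` on
the words of the base. A vertex reached horizontally is therefore given by its initial part in the
base and one element of `S` applied to the fixed final part. Recording also how `F^k` maps the
bottom level leaves finitely many possible data, and equal data give isometric maps
(`isometricallyIsomorphic_of_data_eq`). -/

namespace SelfSim

open scoped Pointwise

universe u v

/-! ### Restrictions of group elements. -/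

section Restriction
variable {G : Type u} {X : Type v} [Group G] [MulAction G (List X)]

theorem exists_isRestriction (hG : IsSelfSimilar G X) (g : G) (w : List X) :
    ∃ h : G, IsRestriction g w h := by
  induction w generalizing g with
  | nil => exact ⟨g, fun w => by simp [smul_nil hG]⟩
  | cons x w ih =>
    obtain ⟨y, h, hw⟩ := hG g x
    obtain ⟨h', hh'⟩ := ih h
    exact ⟨h', fun u => by rw [List.cons_append, hw, hw, hh', List.cons_append]⟩

theorem isRestriction_one (w : List X) : IsRestriction (1 : G) w 1 := fun u => by simp

theorem IsRestriction.mul {g g' h h' : G} {w : List X} (h1 : IsRestriction g (g' • w) h)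
    (h2 : IsRestriction g' w h') : IsRestriction (g * g') w (h * h') := fun u => by
  rw [mul_smul, h2, h1, mul_smul, mul_smul]

/-- This is what moves a group element past the deletion of front letters, that is, towards the
root. -/
theorem IsRestriction.smul_drop (hG : IsSelfSimilar G X) {g h : G} {w : List X} {i : ℕ}
    (hh : IsRestriction g (w.take i) h) : (g • w).drop i = h • w.drop i := by
  rcases le_total i w.length with hi | hi
  · have := hh (w.drop i)
    rw [List.take_append_drop] at this
    rw [this, List.drop_append_of_le_length (by rw [length_smul hG]; simp [hi]),
      List.drop_of_length_le (by rw [length_smul hG]; simp), List.nil_append]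
  · rw [List.drop_of_length_le (by rwa [length_smul hG]), List.drop_of_length_le hi, smul_nil hG]

theorem IsRestriction.smul_append_eq_iff (hG : IsSelfSimilar G X) {g h : G} {w w' b b' : List X}
    (hh : IsRestriction g w h) (hw : w.length = w'.length) :
    g • (w ++ b) = w' ++ b' ↔ g • w = w' ∧ h • b = b' := by
  rw [hh b]
  exact ⟨fun h => List.append_inj h (by rw [length_smul hG, hw]), fun h => by rw [h.1, h.2]⟩

end Restriction

/-! ### Word balls `insert 1 S ^ m`, the nucleus and contraction. -/

section Balls
variable {G : Type u} {X : Type v} [Group G] [MulAction G (List X)] {S : Set G}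

/-- The cocycle rule restricts a product factor by factor, and `S` is closed under restrictions, so
word length never grows. -/
theorem exists_isRestriction_mem_pow (hG : IsSelfSimilar G X) (hS : RestrictionClosed X S)
    {m : ℕ} {g : G} (hg : g ∈ insert 1 S ^ m) (w : List X) :
    ∃ h ∈ insert 1 S ^ m, IsRestriction g w h := by
  induction m generalizing g w with
  | zero =>
    rw [pow_zero, Set.mem_one] at hg
    subst hg
    exact ⟨1, by simp, isRestriction_one w⟩
  | succ m ih =>
    rw [pow_succ] at hg ⊢
    obtain ⟨g₁, hg₁, s, hs, rfl⟩ := Set.mem_mul.1 hg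
    have key : ∃ h ∈ insert 1 S, IsRestriction s w h := by
      rcases hs with rfl | hs
      · exact ⟨1, Set.mem_insert _ _, isRestriction_one w⟩
      · obtain ⟨h, hh⟩ := exists_isRestriction hG s w
        exact ⟨h, Set.mem_insert_of_mem _ (hS s hs w h hh), hh⟩
    obtain ⟨h, hh, hr⟩ := key
    obtain ⟨h', hh', hr'⟩ := ih hg₁ (s • w)
    exact ⟨h' * h, Set.mul_mem_mul hh' hh, hr'.mul hr⟩

theorem insert_one_pow_subset {m n : ℕ} (h : m ≤ n) : insert 1 S ^ m ⊆ insert 1 S ^ n :=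
  Set.pow_subset_pow_right (Set.mem_insert _ _) h

theorem finite_insert_one_pow (hfin : S.Finite) (m : ℕ) : (insert 1 S ^ m : Set G).Finite := by
  induction m with
  | zero => simp
  | succ m ih => rw [pow_succ]; exact ih.mul (hfin.insert 1)

/-- Start from one finite attracting set `N`. Each element of `N` outside the nucleus is missed by
some attracting set; only finitely many such sets are needed, so for each `g` the largest of their
thresholds works. -/
theorem attracts_nucleus (hc : IsContracting G X) : Attracts X (nucleus G X) := by
  obtain ⟨N, hN, hA⟩ := hc
  have hB : ∀ a : N, ∃ M : Set G, (M.Finite ∧ Attracts X M) ∧ ((a : G) ∈ M → (a : G) ∈ nucleus G X) := by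
    intro a
    by_cases ha : (a : G) ∈ nucleus G X
    · exact ⟨N, ⟨hN, hA⟩, fun _ => ha⟩
    · have : ∃ M : Set G, (M.Finite ∧ Attracts X M) ∧ (a : G) ∉ M := by
        simpa [nucleus, Set.mem_sInter, and_assoc] using ha
      obtain ⟨M, hM, hn⟩ := this
      exact ⟨M, hM, fun h => absurd h hn⟩
  choose M hM hMn using hB
  intro g
  obtain ⟨n₀, h₀⟩ := hA g
  choose n hn using fun a => (hM a).2 g
  have := hN.to_subtype
  obtain ⟨n₁, h₁⟩ := (Set.finite_range n).bddAbove
  refine ⟨max n₀ n₁, fun v hv h hh => ?_⟩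
  have hhN := h₀ v ((le_max_left _ _).trans hv) h hh
  exact hMn ⟨h, hhN⟩ (hn ⟨h, hhN⟩ v ((h₁ ⟨_, rfl⟩).trans ((le_max_right _ _).trans hv)) h hh)

theorem Attracts.mono {N N' : Set G} (h : Attracts X N) (hN : N ⊆ N') : Attracts X N' := fun g =>
  let ⟨n, hn⟩ := h g
  ⟨n, fun v hv k hk => hN (hn v hv k hk)⟩

theorem Attracts.uniform {N A : Set G} (h : Attracts X N) (hA : A.Finite) :
    ∃ n : ℕ, ∀ g ∈ A, ∀ v : List X, n ≤ v.length → ∀ k : G, IsRestriction g v k → k ∈ N := by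
  choose n hn using h
  obtain ⟨m, hm⟩ := (hA.image n).bddAbove
  exact ⟨m, fun g hg v hv => hn g v ((hm ⟨g, hg, rfl⟩).trans hv)⟩

/-- Cut a word into blocks of length `4`; on words of length at least `L` each block restricts to a
single generator. Any fixed block length above `1` would serve as well. -/
theorem exists_isRestriction_mem_pow_of_contracting (hG : IsSelfSimilar G X)
    (hS : RestrictionClosed X S) {L : ℕ}
    (hL : ∀ g ∈ insert 1 S ^ 4, ∀ v : List X, L ≤ v.length → ∀ k : G, IsRestriction g v k → k ∈ S)
    (q t : ℕ) {g : G} (hg : g ∈ insert 1 S ^ (4 * q + t)) {w : List X} (hw : L ≤ w.length) :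
    ∃ h ∈ insert 1 S ^ (q + t), IsRestriction g w h := by
  induction q generalizing g with
  | zero => simpa using exists_isRestriction_mem_pow hG hS (by simpa using hg) w
  | succ q ih =>
    rw [show 4 * (q + 1) + t = 4 + (4 * q + t) by ring, pow_add] at hg
    obtain ⟨g₁, h₁, g₂, h₂, rfl⟩ := Set.mem_mul.1 hg
    obtain ⟨k₂, hk₂, hr₂⟩ := ih h₂
    obtain ⟨k₁, hr₁⟩ := exists_isRestriction hG g₁ (g₂ • w)
    refine ⟨k₁ * k₂, ?_, hr₁.mul hr₂⟩
    rw [show q + 1 + t = 1 + (q + t) by ring, pow_add, pow_one]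
    exact Set.mul_mem_mul (Set.mem_insert_of_mem _
      (hL g₁ h₁ _ (by rwa [length_smul hG]) k₁ hr₁)) hk₂

end Balls

/-! ### Geodesics in normal form. -/

section Distance
variable {G : Type u} {X : Type v} [Group G] [MulAction G (List X)] {S : Set G}

theorem skeleton_adj_cases (hsymm : ∀ s ∈ S, s⁻¹ ∈ S) {a b : List X}
    (h : (skeleton X S).Adj a b) :
    (∃ s ∈ S, b = s • a) ∨ (∃ x, b = x :: a) ∨ ∃ x, a = x :: b := by
  rw [skeleton, SimpleGraph.fromRel_adj] at h
  obtain ⟨-, ⟨e, rfl, rfl⟩ | ⟨e, rfl, rfl⟩⟩ := h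
  · cases e with
    | horiz w s => exact Or.inl ⟨s, s.2, rfl⟩
    | vert w x => exact Or.inr (Or.inl ⟨x, rfl⟩)
  · cases e with
    | horiz w s => exact Or.inl ⟨(s : G)⁻¹, hsymm s s.2, by simp [Cell.src, Cell.tgt]⟩
    | vert w x => exact Or.inr (Or.inr ⟨x, rfl⟩)

theorem dist_src_tgt_le (e : Cell X S) : (skeleton X S).dist e.src e.tgt ≤ 1 := by
  have := vdist_src_tgt e
  unfold vdist at this
  exact_mod_cast this

theorem dist_smul_le_one {s : G} (hs : s ∈ S) (a : List X) :
    (skeleton X S).dist a (s • a) ≤ 1 :=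
  dist_src_tgt_le (Cell.horiz a ⟨s, hs⟩)

theorem dist_cons_le_one (x : X) (a : List X) : (skeleton X S).dist (x :: a) a ≤ 1 := by
  rw [SimpleGraph.dist_comm]
  exact dist_src_tgt_le (Cell.vert a x : Cell X S)

theorem dist_smul_le {m : ℕ} {g : G} (hg : g ∈ insert 1 S ^ m) (a : List X) :
    (skeleton X S).dist a (g • a) ≤ m := by
  induction m generalizing g a with
  | zero =>
    rw [pow_zero, Set.mem_one] at hg
    simp [hg]
  | succ m ih =>
    rw [pow_succ] at hg
    obtain ⟨g₁, hg₁, s, hs, rfl⟩ := Set.mem_mul.1 hg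
    have h1 : (skeleton X S).dist a (s • a) ≤ 1 := by
      rcases hs with rfl | hs
      · simp
      · exact dist_smul_le_one hs a
    have h2 := ih hg₁ (s • a)
    have h3 := (skeleton_connected X S).dist_triangle (u := a) (v := s • a) (w := g₁ • s • a)
    rw [mul_smul]
    omega

theorem dist_append_le (w a : List X) : (skeleton X S).dist (w ++ a) a ≤ w.length := by
  induction w with
  | nil => simp
  | cons x w ih =>
    have h1 := dist_cons_le_one (S := S) x (w ++ a)
    have h2 := (skeleton_connected X S).dist_triangle (u := x :: (w ++ a)) (v := w ++ a) (w := a)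
    rw [List.cons_append, List.length_cons]
    omega

theorem dist_drop_le (i : ℕ) (a : List X) : (skeleton X S).dist a (a.drop i) ≤ i := by
  have := dist_append_le (S := S) (a.take i) (a.drop i)
  rw [List.take_append_drop] at this
  exact this.trans (by simp)

theorem dist_le_of_smul_drop {i j m : ℕ} {g : G} (hg : g ∈ insert 1 S ^ m) {a b : List X}
    (h : g • a.drop i = b.drop j) : (skeleton X S).dist a b ≤ i + j + m := by
  have h1 := dist_drop_le (S := S) i a
  have h2 := dist_drop_le (S := S) j b
  have h3 := dist_smul_le hg (a.drop i)
  have h4 := (skeleton_connected X S).dist_triangle (u := a) (v := a.drop i) (w := b)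
  have h5 := (skeleton_connected X S).dist_triangle (u := a.drop i) (v := b.drop j) (w := b)
  rw [h] at h3
  rw [SimpleGraph.dist_comm] at h2
  omega

/-- Induction on the walk, prepending one edge. A horizontal edge is restricted and absorbed into
`g`, a deletion increases `i`, and an insertion cancels a later deletion if there is one. -/
theorem exists_normal_form_of_walk (hG : IsSelfSimilar G X) (hsymm : ∀ s ∈ S, s⁻¹ ∈ S)
    (hS : RestrictionClosed X S) {a b : List X} (p : (skeleton X S).Walk a b) :
    ∃ i j m : ℕ, ∃ g ∈ insert 1 S ^ m, i ≤ a.length ∧ j ≤ b.length ∧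
      g • a.drop i = b.drop j ∧ i + j + m ≤ p.length := by
  induction p with
  | nil => exact ⟨0, 0, 0, 1, by simp, by simp⟩
  | @cons a c b hadj p ih =>
    obtain ⟨i, j, m, g, hg, hi, hj, h, hle⟩ := ih
    rw [SimpleGraph.Walk.length_cons]
    rcases skeleton_adj_cases hsymm hadj with ⟨s, hs, rfl⟩ | ⟨x, rfl⟩ | ⟨x, rfl⟩
    · obtain ⟨k, hk⟩ := exists_isRestriction hG s (a.take i)
      refine ⟨i, j, m + 1, g * k, ?_, by rwa [length_smul hG] at hi, hj, ?_, by omega⟩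
      · rw [pow_succ]
        exact Set.mul_mem_mul hg (Set.mem_insert_of_mem _ (hS s hs _ k hk))
      · rw [mul_smul, ← hk.smul_drop hG, h]
    · rcases i with _ | i
      -- With no deletion to cancel, the inserted letter is carried through `g` and becomes one more
      -- inserted letter of `b`, while `g` is replaced by its restriction to that letter.
      · obtain ⟨k, hk, hr⟩ := exists_isRestriction_mem_pow hG hS hg [x]
        have h1 : (g • (x :: a)).drop 1 = k • (x :: a).drop 1 :=
          IsRestriction.smul_drop hG (by simpa using hr)
        rw [List.drop_zero] at h
        refine ⟨0, j + 1, m, k, hk, by simp, ?_, ?_, by omega⟩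
        · have := congrArg List.length h
          rw [length_smul hG, List.length_drop, List.length_cons] at this
          omega
        · rw [h, List.drop_drop] at h1
          simpa [eq_comm, add_comm] using h1
      · refine ⟨i, j, m, g, hg, by simpa using hi, hj, by simpa using h, by omega⟩
    · exact ⟨i + 1, j, m, g, hg, by simpa using hi, hj, by simpa using h, by omega⟩

theorem exists_normal_form (hG : IsSelfSimilar G X) (hsymm : ∀ s ∈ S, s⁻¹ ∈ S)
    (hS : RestrictionClosed X S) (a b : List X) :
    ∃ i j m : ℕ, ∃ g ∈ insert 1 S ^ m, i ≤ a.length ∧ j ≤ b.length ∧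
      g • a.drop i = b.drop j ∧ i + j + m = (skeleton X S).dist a b := by
  obtain ⟨p, hp⟩ := (skeleton_connected X S).exists_walk_length_eq_dist a b
  obtain ⟨i, j, m, g, hg, hi, hj, h, hle⟩ := exists_normal_form_of_walk hG hsymm hS p
  exact ⟨i, j, m, g, hg, hi, hj, h, le_antisymm (hp ▸ hle) (dist_le_of_smul_drop hg h)⟩

theorem exists_bounded_normal_form (hG : IsSelfSimilar G X) (hfin : S.Finite)
    (hsymm : ∀ s ∈ S, s⁻¹ ∈ S) (hS : RestrictionClosed X S) (hA : Attracts X S) :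
    ∃ C : ℕ, ∀ a b : List X, ∃ i j m : ℕ, ∃ g ∈ insert 1 S ^ m, i ≤ a.length ∧ j ≤ b.length ∧
      g • a.drop i = b.drop j ∧ i + j + m = (skeleton X S).dist a b ∧ m ≤ C := by
  obtain ⟨L, hL⟩ := hA.uniform (finite_insert_one_pow hfin 4)
  -- Write `m = 4 * q + t` with `t ≤ 3`. Going `L` letters deeper on both sides replaces `m` by `q +
  -- t` at cost `2 * L`, so minimality gives `3 * q ≤ 2 * L`.
  refine ⟨4 * L + 3, fun a b => ?_⟩
  obtain ⟨i, j, m, g, hg, hi, hj, h, hd⟩ := exists_normal_form hG hsymm hS a b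
  refine ⟨i, j, m, g, hg, hi, hj, h, hd, ?_⟩
  have hlen := congrArg List.length h
  rw [length_smul hG, List.length_drop, List.length_drop] at hlen
  rcases lt_or_ge (a.drop i).length L with hlt | hge
  · rw [List.length_drop] at hlt
    -- The remaining words are shorter than `L`, so the path through the root already forces `m < 2
    -- * L`.
    have h1 : (skeleton X S).dist a b ≤ a.length + b.length + 0 :=
      dist_le_of_smul_drop (g := 1) (by simp) (by simp)
    omega
  · obtain ⟨k, hk, hr⟩ := exists_isRestriction_mem_pow_of_contracting hG hS hL (m / 4) (m % 4)
      (by rwa [Nat.div_add_mod]) (w := (a.drop i).take L) (by simpa using hge)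
    have h1 := hr.smul_drop hG
    rw [h, List.drop_drop, List.drop_drop] at h1
    have h2 := dist_le_of_smul_drop hk h1.symm
    omega

end Distance

/-! ### From vertex bijections to isometries of subcomplexes and of maps. -/

section VertexIso
variable {G : Type u} {X : Type v} [Group G] [MulAction G (List X)] {S : Set G}

/-- `α` and `α'` restrict to mutually inverse bijections between the vertex sets `A` and `A'`, which
preserve the distance and carry the labelled 1-cells of the induced subcomplexes to each other. -/
structure VertexIso (S : Set G) (A A' : Set (List X)) (α α' : List X → List X) : Prop where
  mapsTo : Set.MapsTo α A A'
  mapsTo' : Set.MapsTo α' A' A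
  left_inv : ∀ a ∈ A, α' (α a) = a
  right_inv : ∀ a ∈ A', α (α' a) = a
  dist_eq : ∀ a ∈ A, ∀ b ∈ A, (skeleton X S).dist (α a) (α b) = (skeleton X S).dist a b
  smul : ∀ s ∈ S, ∀ a ∈ A, s • a ∈ A → α (s • a) = s • α a
  smul' : ∀ s ∈ S, ∀ a ∈ A', s • a ∈ A' → α' (s • a) = s • α' a
  cons : ∀ (x : X), ∀ a ∈ A, x :: a ∈ A → α (x :: a) = x :: α a
  cons' : ∀ (x : X), ∀ a ∈ A', x :: a ∈ A' → α' (x :: a) = x :: α' a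

/-- The action on 1-cells of a map on vertices, preserving labels. -/
def Cell.map (α : List X → List X) : Cell X S → Cell X S
  | .horiz w s => .horiz (α w) s
  | .vert w x => .vert (α w) x

/-- The action on points of a map on vertices, preserving labels. -/
def Point.map (α : List X → List X) : Point X S → Point X S
  | .vertex w => .vertex (α w)
  | .interior e t => .interior (e.map α) t

theorem Cell.map_src (α : List X → List X) (e : Cell X S) : (e.map α).src = α e.src := by
  cases e <;> rfl

theorem Cell.map_map {α α' : List X → List X} {e : Cell X S} (h : α' (α e.src) = e.src) :
    (e.map α).map α' = e := by
  cases e <;> simp_all [Cell.map, Cell.src]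

namespace VertexIso
variable {A A' : Set (List X)} {α α' : List X → List X}

theorem symm (H : VertexIso S A A' α α') : VertexIso S A' A α' α where
  mapsTo := H.mapsTo'
  mapsTo' := H.mapsTo
  left_inv := H.right_inv
  right_inv := H.left_inv
  dist_eq a ha b hb := by
    rw [← H.dist_eq _ (H.mapsTo' ha) _ (H.mapsTo' hb), H.right_inv a ha, H.right_inv b hb]
  smul := H.smul'
  smul' := H.smul
  cons := H.cons'
  cons' := H.cons

theorem restrict (H : VertexIso S A A' α α') {B B' : Set (List X)} (hB : B ⊆ A) (hB' : B' ⊆ A')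
    (h : Set.MapsTo α B B') (h' : Set.MapsTo α' B' B) : VertexIso S B B' α α' where
  mapsTo := h
  mapsTo' := h'
  left_inv a ha := H.left_inv a (hB ha)
  right_inv a ha := H.right_inv a (hB' ha)
  dist_eq a ha b hb := H.dist_eq a (hB ha) b (hB hb)
  smul s hs a ha hsa := H.smul s hs a (hB ha) (hB hsa)
  smul' s hs a ha hsa := H.smul' s hs a (hB' ha) (hB' hsa)
  cons x a ha hxa := H.cons x a (hB ha) (hB hxa)
  cons' x a ha hxa := H.cons' x a (hB' ha) (hB' hxa)

theorem vdist_eq (H : VertexIso S A A' α α') {a b : List X} (ha : a ∈ A) (hb : b ∈ A) :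
    vdist X S (α a) (α b) = vdist X S a b := by
  unfold vdist
  rw [H.dist_eq a ha b hb]

theorem map_tgt (H : VertexIso S A A' α α') {e : Cell X S} (hs : e.src ∈ A) (ht : e.tgt ∈ A) :
    (e.map α).tgt = α e.tgt := by
  cases e with
  | horiz w s => exact (H.smul s s.2 w hs ht).symm
  | vert w x => exact (H.cons x w hs ht).symm

theorem map_mem (H : VertexIso S A A' α α') {p : Point X S} (hp : p ∈ induced A) :
    p.map α ∈ induced A' := by
  cases p with
  | vertex w => exact H.mapsTo hp
  | interior e t =>
    refine ⟨?_, ?_⟩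
    · rw [Cell.map_src]; exact H.mapsTo hp.1
    · rw [H.map_tgt hp.1 hp.2]; exact H.mapsTo hp.2

theorem map_map (H : VertexIso S A A' α α') {p : Point X S} (hp : p ∈ induced A) :
    (p.map α).map α' = p := by
  cases p with
  | vertex w => exact congrArg Point.vertex (H.left_inv w hp)
  | interior e t =>
    simp only [Point.map]
    rw [Cell.map_map (H.left_inv _ hp.1)]

theorem toVertex_map (H : VertexIso S A A' α α') {p : Point X S} (hp : p ∈ induced A)
    {a : List X} (ha : a ∈ A) : (p.map α).toVertex (α a) = p.toVertex a := by
  cases p with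
  | vertex w => exact H.vdist_eq hp ha
  | interior e t =>
    simp only [Point.map, Point.toVertex]
    rw [Cell.map_src, H.map_tgt hp.1 hp.2, H.vdist_eq hp.1 ha, H.vdist_eq hp.2 ha]

theorem through_map (H : VertexIso S A A' α α') {p q : Point X S} (hp : p ∈ induced A)
    (hq : q ∈ induced A) : (p.map α).through (q.map α) = p.through q := by
  cases p with
  | vertex w => exact H.toVertex_map hq hp
  | interior e t =>
    have h1 := H.toVertex_map hq hp.1
    have h2 := H.toVertex_map hq hp.2
    rw [← Cell.map_src α e] at h1
    rw [← H.map_tgt hp.1 hp.2] at h2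
    change min (t + (q.map α).toVertex (e.map α).src) (1 - t + (q.map α).toVertex (e.map α).tgt) =
      min (t + q.toVertex e.src) (1 - t + q.toVertex e.tgt)
    rw [h1, h2]

theorem dist_map (H : VertexIso S A A' α α') {p q : Point X S} (hp : p ∈ induced A)
    (hq : q ∈ induced A) : dist (p.map α) (q.map α) = dist p q := by
  have ht := H.through_map hp hq
  change (p.map α).pointDist (q.map α) = p.pointDist q
  cases p with
  | vertex w => exact ht
  | interior e t =>
    cases q with
    | vertex w => exact ht
    | interior e' t' =>
      have he : e.map α = e'.map α ↔ e = e' := by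
        refine ⟨fun h => ?_, fun h => by rw [h]⟩
        rw [← Cell.map_map (H.left_inv _ hp.1), h, Cell.map_map (H.left_inv _ hq.1)]
      simp only [Point.map] at ht ⊢
      simp only [Point.pointDist, ht]
      by_cases h : e = e'
      · rw [if_pos (he.2 h), if_pos h]
      · rw [if_neg (mt he.1 h), if_neg h]

/-- The isometry of induced subcomplexes given by an isomorphism of vertex sets. -/
noncomputable def isometryEquiv (H : VertexIso S A A' α α') :
    (induced A : Set (Point X S)) ≃ᵢ (induced A' : Set (Point X S)) where
  toFun p := ⟨p.1.map α, H.map_mem p.2⟩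
  invFun p := ⟨p.1.map α', H.symm.map_mem p.2⟩
  left_inv p := Subtype.ext (H.map_map p.2)
  right_inv p := Subtype.ext (H.symm.map_map p.2)
  isometry_toFun := Isometry.of_dist_eq fun p q => H.dist_map p.2 q.2

theorem isCellular (H : VertexIso S A A' α α') : IsCellular H.isometryEquiv := by
  rintro ⟨w | ⟨e, t⟩, hp⟩ <;> simp [isometryEquiv, Point.map]

end VertexIso

theorem iterate_shift_map {α β : List X → List X} {k k' : ℕ} {e : Cell X S}
    (h : β (List.dropLast^[k] e.src) = List.dropLast^[k'] (α e.src)) :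
    (Cell.shift^[k] e).map β = Cell.shift^[k'] (e.map α) := by
  have h1 : ∀ (j : ℕ) (w : List X) (s : S), Cell.shift^[j] (Cell.horiz w s) =
      Cell.horiz (List.dropLast^[j] w) s := by
    intro j
    induction j with
    | zero => intros; rfl
    | succ j ih => intro w s; rw [Function.iterate_succ_apply, Cell.shift, ih]; rfl
  have h2 : ∀ (j : ℕ) (w : List X) (x : X), Cell.shift^[j] (Cell.vert w x : Cell X S) =
      Cell.vert (List.dropLast^[j] w) x := by
    intro j
    induction j with
    | zero => intros; rfl
    | succ j ih => intro w s; rw [Function.iterate_succ_apply, Cell.shift, ih]; rfl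
  cases e with
  | horiz w s =>
    simp only [Cell.map, h1]
    rw [show β (List.dropLast^[k] w) = _ from h]; rfl
  | vert w x =>
    simp only [Cell.map, h2]
    rw [show β (List.dropLast^[k] w) = _ from h]; rfl

/-- A 1-cell is determined by its source and label, and all maps involved preserve labels, so
commutation on vertices is enough. -/
theorem isometricallyIsomorphic_of_vertexIso {A A' B B' : Set (List X)}
    {α α' β β' : List X → List X} (HA : VertexIso S A A' α α') (HB : VertexIso S B B' β β')
    {k k' : ℕ} (h : ∀ a ∈ A, β (List.dropLast^[k] a) = List.dropLast^[k'] (α a))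
    (hk : Set.MapsTo (Point.F^[k]) (induced A : Set (Point X S)) (induced B))
    (hk' : Set.MapsTo (Point.F^[k']) (induced A' : Set (Point X S)) (induced B')) :
    IsometricallyIsomorphic (⟨induced A, induced B, hk.restrict⟩ : SubcomplexMap X S)
      ⟨induced A', induced B', hk'.restrict⟩ := by
  refine ⟨HA.isometryEquiv, HB.isometryEquiv, HA.isCellular, HB.isCellular, ?_⟩
  rintro ⟨w | ⟨e, t⟩, hp⟩ <;> apply Subtype.ext
  · change (Point.F^[k] (.vertex w : Point X S)).map β = Point.F^[k'] (.vertex (α w))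
    rw [iterate_F_vertex, iterate_F_vertex, Point.map, h w hp]
  · change (Point.F^[k] (.interior e t : Point X S)).map β = Point.F^[k'] (.interior (e.map α) t)
    rw [iterate_F_interior, iterate_F_interior, Point.map, iterate_shift_map (h _ hp.1)]

theorem mem_shadow {V : Set (List X)} {u : List X} :
    u ∈ shadow V ↔ ∃ w, ∃ b ∈ V, u = w ++ b := by
  simp only [shadow, Set.mem_iUnion, exists_prop]
  exact ⟨fun ⟨b, hb, w, h⟩ => ⟨w, b, hb, h⟩, fun ⟨w, b, hb, h⟩ => ⟨b, hb, w, h⟩⟩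

theorem cons_mem_shadow {V : Set (List X)} {u : List X} (h : u ∈ shadow V) (x : X) :
    x :: u ∈ shadow V := by
  obtain ⟨w, b, hb, rfl⟩ := mem_shadow.1 h
  exact mem_shadow.2 ⟨x :: w, b, hb, rfl⟩

/-- Membership in the umbra only concerns neighbours. All neighbours of `u` lie in the shadow, and
`α` respects labels, so every neighbour of `α u` lies in the target shadow. -/
theorem VertexIso.mapsTo_umbra (hsymm : ∀ s ∈ S, s⁻¹ ∈ S) {V V' : Set (List X)}
    (hV : [] ∉ V) {α α' : List X → List X}
    (H : VertexIso S (shadow V) (shadow V') α α') :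
    Set.MapsTo α (umbra S V) (umbra S V') := by
  rintro u ⟨hu, hfar⟩
  have hnear : ∀ y, (skeleton X S).dist u y ≤ 1 → y ∈ shadow V := fun y hy => by
    by_contra hc
    exact absurd (hfar y hc) (by omega)
  refine ⟨H.mapsTo hu, fun y hy => ?_⟩
  by_contra hle
  have hne : α u ≠ y := fun h => hy (h ▸ H.mapsTo hu)
  have hpos := (skeleton_connected X S).pos_dist_of_ne hne
  have hadj : (skeleton X S).Adj (α u) y := SimpleGraph.dist_eq_one_iff_adj.1 (by omega)
  refine hy ?_
  rcases skeleton_adj_cases hsymm hadj with ⟨s, hs, rfl⟩ | ⟨x, rfl⟩ | ⟨x, hx⟩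
  · have hsu := hnear _ (dist_smul_le_one hs u)
    rw [← H.smul s hs u hu hsu]
    exact H.mapsTo hsu
  · exact cons_mem_shadow (H.mapsTo hu) x
  · obtain ⟨w, b, hb, rfl⟩ := mem_shadow.1 hu
    -- Since `[] ∉ V`, the vertex has a first letter to delete, hence a lower neighbour `z` to
    -- compare with the one below `α u`.
    obtain ⟨x', z, hz⟩ : ∃ x' z, w ++ b = x' :: z := by
      rcases h : w ++ b with _ | ⟨x', z⟩
      · rw [List.append_eq_nil_iff] at h
        exact absurd (h.2 ▸ hb) hV
      · exact ⟨x', z, rfl⟩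
    rw [hz] at hu hx hnear
    have hzV := hnear z (dist_cons_le_one x' z)
    rw [H.cons x' z hzV hu] at hx
    rw [← (List.cons.inj hx).2]
    exact H.mapsTo hzV

end VertexIso

/-! ### Shadows are determined by finite data on their bottom level. -/

section BaseIso
variable {G : Type u} {X : Type v} [Group G] [MulAction G (List X)] {S : Set G}

/-- `β` and `β'` restrict to mutually inverse bijections between the horizontal vertex sets `V` (at
level `l`) and `V'` (at level `l'`), which preserve the distance and the action of the group
elements of length at most `C`. -/
structure BaseIso (S : Set G) (C l l' : ℕ) (V V' : Set (List X)) (β β' : List X → List X) :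
    Prop where
  mapsTo : Set.MapsTo β V V'
  mapsTo' : Set.MapsTo β' V' V
  left_inv : ∀ a ∈ V, β' (β a) = a
  right_inv : ∀ a ∈ V', β (β' a) = a
  dist_eq : ∀ a ∈ V, ∀ b ∈ V, (skeleton X S).dist (β a) (β b) = (skeleton X S).dist a b
  smul_iff : ∀ g ∈ insert 1 S ^ C, ∀ a ∈ V, ∀ b ∈ V, g • β a = β b ↔ g • a = b
  length_eq : ∀ a ∈ V, a.length = l
  length_eq' : ∀ a ∈ V', a.length = l'

/-- The extension to shadows of a map defined at level `l`. -/
def extendAbove (l : ℕ) (β : List X → List X) (u : List X) : List X :=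
  u.take (u.length - l) ++ β (u.drop (u.length - l))

theorem extendAbove_append {l : ℕ} {b : List X} (hb : b.length = l) (β : List X → List X)
    (w : List X) : extendAbove l β (w ++ b) = w ++ β b := by
  unfold extendAbove
  rw [show (w ++ b).length - l = w.length by simp [hb], List.take_left, List.drop_left]

namespace BaseIso
variable {C l l' : ℕ} {V V' : Set (List X)} {β β' : List X → List X}

theorem symm (H : BaseIso S C l l' V V' β β') : BaseIso S C l' l V' V β' β where
  mapsTo := H.mapsTo'
  mapsTo' := H.mapsTo
  left_inv := H.right_inv
  right_inv := H.left_inv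
  dist_eq a ha b hb := by
    rw [← H.dist_eq _ (H.mapsTo' ha) _ (H.mapsTo' hb), H.right_inv a ha, H.right_inv b hb]
  smul_iff g hg a ha b hb := by
    rw [← H.smul_iff g hg _ (H.mapsTo' ha) _ (H.mapsTo' hb), H.right_inv a ha, H.right_inv b hb]
  length_eq := H.length_eq'
  length_eq' := H.length_eq

theorem extend_append (H : BaseIso S C l l' V V' β β') {b : List X} (hb : b ∈ V) (w : List X) :
    extendAbove l β (w ++ b) = w ++ β b :=
  extendAbove_append (H.length_eq b hb) β w

theorem mapsTo_extend (H : BaseIso S C l l' V V' β β') :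
    Set.MapsTo (extendAbove l β) (shadow V) (shadow V') := fun u hu => by
  obtain ⟨w, b, hb, rfl⟩ := mem_shadow.1 hu
  rw [H.extend_append hb]
  exact mem_shadow.2 ⟨w, β b, H.mapsTo hb, rfl⟩

theorem extend_extend (H : BaseIso S C l l' V V' β β') {u : List X} (hu : u ∈ shadow V) :
    extendAbove l' β' (extendAbove l β u) = u := by
  obtain ⟨w, b, hb, rfl⟩ := mem_shadow.1 hu
  rw [H.extend_append hb, H.symm.extend_append (H.mapsTo hb), H.left_inv b hb]

theorem extend_cons (H : BaseIso S C l l' V V' β β') (x : X) {u : List X} (hu : u ∈ shadow V) :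
    extendAbove l β (x :: u) = x :: extendAbove l β u := by
  obtain ⟨w, b, hb, rfl⟩ := mem_shadow.1 hu
  rw [← List.cons_append, H.extend_append hb, H.extend_append hb, List.cons_append]

/-- The equation `g • (w ++ b) = w' ++ b'` splits into one on the prefixes, which the extension
leaves alone, and one on the base involving a restriction of `g`, still of length at most `C`. -/
theorem extend_smul (hG : IsSelfSimilar G X) (hS : RestrictionClosed X S)
    (H : BaseIso S C l l' V V' β β') {g : G} (hg : g ∈ insert 1 S ^ C) {u : List X}
    (hu : u ∈ shadow V) (hgu : g • u ∈ shadow V) :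
    extendAbove l β (g • u) = g • extendAbove l β u := by
  obtain ⟨w, b, hb, rfl⟩ := mem_shadow.1 hu
  obtain ⟨w', b', hb', he⟩ := mem_shadow.1 hgu
  obtain ⟨h, hh, hr⟩ := exists_isRestriction_mem_pow hG hS hg w
  have hlen : w.length = w'.length := by
    have := congrArg List.length he
    rw [length_smul hG, List.length_append, List.length_append, H.length_eq b hb,
      H.length_eq b' hb'] at this
    omega
  obtain ⟨h1, h2⟩ := (hr.smul_append_eq_iff hG hlen).1 he
  rw [he, H.extend_append hb', H.extend_append hb, eq_comm, hr.smul_append_eq_iff hG hlen]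
  exact ⟨h1, (H.smul_iff h hh b hb b' hb').2 h2⟩

theorem dist_extend_le (hG : IsSelfSimilar G X) (hS : RestrictionClosed X S)
    (hC : ∀ a b : List X, ∃ i j m : ℕ, ∃ g ∈ insert 1 S ^ m, i ≤ a.length ∧ j ≤ b.length ∧
      g • a.drop i = b.drop j ∧ i + j + m = (skeleton X S).dist a b ∧ m ≤ C)
    (H : BaseIso S C l l' V V' β β') {u u' : List X} (hu : u ∈ shadow V) (hu' : u' ∈ shadow V) :
    (skeleton X S).dist (extendAbove l β u) (extendAbove l β u') ≤ (skeleton X S).dist u u' := by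
  obtain ⟨i, j, m, g, hg, hi, hj, h, hd, hm⟩ := hC u u'
  obtain ⟨w, b, hb, rfl⟩ := mem_shadow.1 hu
  obtain ⟨w', b', hb', rfl⟩ := mem_shadow.1 hu'
  rw [H.extend_append hb, H.extend_append hb', ← hd]
  have hlb := H.length_eq b hb
  have hlb' := H.length_eq b' hb'
  have hlen := congrArg List.length h
  simp only [length_smul hG, List.length_drop, List.length_append] at hlen hi hj
  -- Either the geodesic stays at or above the base, and the bound `m ≤ C` lets `smul_iff` transport
  -- it, or it dips below.
  rcases le_or_gt i w.length with hiw | hiw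
  · have hjw : j ≤ w'.length := by omega
    refine dist_le_of_smul_drop hg ?_
    rw [List.drop_append_of_le_length hiw, List.drop_append_of_le_length hjw] at h ⊢
    obtain ⟨k, hk, hr⟩ := exists_isRestriction_mem_pow hG hS hg (w.drop i)
    have hlen' : (w.drop i).length = (w'.drop j).length := by
      rw [List.length_drop, List.length_drop]; omega
    rw [hr.smul_append_eq_iff hG hlen'] at h ⊢
    exact ⟨h.1, (H.smul_iff k (insert_one_pow_subset hm hk) b hb b' hb').2 h.2⟩
  -- Below the base, the geodesic has length at least `|w| + d(b, b') + |w'|`, and `d(b, b')` is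
  -- preserved by `β`.
  · obtain ⟨i, rfl⟩ := Nat.exists_eq_add_of_lt hiw
    obtain ⟨j, rfl⟩ : ∃ j', j = w'.length + j' := ⟨j - w'.length, by omega⟩
    rw [add_assoc, List.drop_length_add_append, List.drop_length_add_append] at h
    have h1 := dist_le_of_smul_drop hg h
    have h2 := dist_append_le (S := S) w (β b)
    have h3 := dist_append_le (S := S) w' (β b')
    have h4 := H.dist_eq b hb b' hb'
    have h5 := (skeleton_connected X S).dist_triangle (u := w ++ β b) (v := β b) (w := w' ++ β b')
    have h6 := (skeleton_connected X S).dist_triangle (u := β b) (v := β b') (w := w' ++ β b')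
    rw [SimpleGraph.dist_comm] at h3
    omega

theorem vertexIso (hG : IsSelfSimilar G X) (hS : RestrictionClosed X S) (hC1 : 1 ≤ C)
    (hC : ∀ a b : List X, ∃ i j m : ℕ, ∃ g ∈ insert 1 S ^ m, i ≤ a.length ∧ j ≤ b.length ∧
      g • a.drop i = b.drop j ∧ i + j + m = (skeleton X S).dist a b ∧ m ≤ C)
    (H : BaseIso S C l l' V V' β β') :
    VertexIso S (shadow V) (shadow V') (extendAbove l β) (extendAbove l' β') := by
  -- `1 ≤ C` ensures that the labels of horizontal 1-cells belong to the recorded action.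
  have hSC : S ⊆ insert 1 S ^ C := fun s hs =>
    insert_one_pow_subset hC1 (by rw [pow_one]; exact Set.mem_insert_of_mem _ hs)
  exact
  { mapsTo := H.mapsTo_extend
    mapsTo' := H.symm.mapsTo_extend
    left_inv := fun a ha => H.extend_extend ha
    right_inv := fun a ha => H.symm.extend_extend ha
    dist_eq := fun a ha b hb => by
      refine le_antisymm (H.dist_extend_le hG hS hC ha hb) ?_
      have := H.symm.dist_extend_le hG hS hC (H.mapsTo_extend ha) (H.mapsTo_extend hb)
      rwa [H.extend_extend ha, H.extend_extend hb] at this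
    smul := fun s hs a ha hsa => H.extend_smul hG hS (hSC hs) ha hsa
    smul' := fun s hs a ha hsa => H.symm.extend_smul hG hS (hSC hs) ha hsa
    cons := fun x a ha _ => H.extend_cons x ha
    cons' := fun x a ha _ => H.symm.extend_cons x ha }

end BaseIso

/-- Finite combinatorial data describing a labelled horizontal vertex set: the action of the group
elements in `T`, and the distances. -/
structure HorizontalData (M : ℕ) (T : Set G) where
  smul : Set (T × Fin M × Fin M)
  dist : Set (Fin M × Fin M × Fin M)

instance {M : ℕ} {T : Set G} [Finite T] : Finite (HorizontalData M T) := by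
  refine Finite.of_injective (fun D => (D.smul, D.dist)) ?_
  rintro ⟨a, b⟩ ⟨a', b'⟩ h
  simpa using h

/-- The data of the vertex set `V`, labelled by `e`. -/
def horizontalData (S : Set G) (C : ℕ) {M : ℕ} (V : Set (List X)) (e : List X → Fin M) :
    HorizontalData M (insert 1 S ^ C) where
  smul := {p | ∃ a ∈ V, ∃ b ∈ V, (p.1 : G) • a = b ∧ p.2 = (e a, e b)}
  dist := {p | ∃ a ∈ V, ∃ b ∈ V, (skeleton X S).dist a b = p.2.2 ∧ p.1 = e a ∧ p.2.1 = e b}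

/-- The bijection matches vertices with equal labels. The bound `hd` is what makes each distance in
`V` a value in `Fin M`, hence recorded. -/
theorem exists_baseIso {C M l l' : ℕ} {V V' : Set (List X)} {e e' : List X → Fin M}
    (he : Set.InjOn e V) (he' : Set.InjOn e' V')
    (hd : ∀ a ∈ V, ∀ b ∈ V, (skeleton X S).dist a b < M)
    (hl : ∀ a ∈ V, a.length = l) (hl' : ∀ a ∈ V', a.length = l')
    (h : horizontalData S C V e = horizontalData S C V' e') :
    ∃ β β' : List X → List X, BaseIso S C l l' V V' β β' ∧ ∀ a ∈ V, e' (β a) = e a := by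
  have hs := congrArg HorizontalData.smul h
  have hdist := congrArg HorizontalData.dist h
  -- The triples `(1, e a, e a)` reveal which labels are in use, so equal data have equal label
  -- sets.
  have h1 : (1 : G) ∈ insert 1 S ^ C := Set.one_mem_pow (Set.mem_insert _ _)
  have hex : ∀ a ∈ V, ∃ b ∈ V', e' b = e a := fun a ha => by
    have hmem : (⟨1, h1⟩, e a, e a) ∈ (horizontalData S C V e).smul := ⟨a, ha, a, ha, by simp⟩
    rw [hs] at hmem
    obtain ⟨b, hb, _, _, _, hp⟩ := hmem
    exact ⟨b, hb, (congrArg Prod.fst hp).symm⟩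
  have hex' : ∀ b ∈ V', ∃ a ∈ V, e a = e' b := fun a ha => by
    have hmem : (⟨1, h1⟩, e' a, e' a) ∈ (horizontalData S C V' e').smul := ⟨a, ha, a, ha, by simp⟩
    rw [← hs] at hmem
    obtain ⟨b, hb, _, _, _, hp⟩ := hmem
    exact ⟨b, hb, (congrArg Prod.fst hp).symm⟩
  choose! β hβ hβe using hex
  choose! β' hβ' hβe' using hex'
  refine ⟨β, β', ⟨hβ, hβ', ?_, ?_, ?_, ?_, hl, hl'⟩, hβe⟩
  · exact fun a ha => he (hβ' _ (hβ a ha)) ha (by rw [hβe' _ (hβ a ha), hβe a ha])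
  · exact fun a ha => he' (hβ _ (hβ' a ha)) ha (by rw [hβe _ (hβ' a ha), hβe' a ha])
  · intro a ha b hb
    have hmem : (e a, e b, (⟨_, hd a ha b hb⟩ : Fin M)) ∈ (horizontalData S C V e).dist :=
      ⟨a, ha, b, hb, rfl, rfl, rfl⟩
    rw [hdist] at hmem
    obtain ⟨a', ha', b', hb', h2, h3, h4⟩ := hmem
    rw [he' (hβ a ha) ha' ((hβe a ha).trans h3), he' (hβ b hb) hb' ((hβe b hb).trans h4)]
    exact h2
  · intro g hg a ha b hb
    constructor
    · intro hgb
      have hmem : (⟨g, hg⟩, e a, e b) ∈ (horizontalData S C V' e').smul :=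
        ⟨β a, hβ a ha, β b, hβ b hb, hgb, by rw [hβe a ha, hβe b hb]⟩
      rw [← hs] at hmem
      obtain ⟨a', ha', b', hb', h2, h3⟩ := hmem
      rw [he ha ha' (congrArg Prod.fst h3), he hb hb' (congrArg Prod.snd h3)]
      exact h2
    · intro hgb
      have hmem : (⟨g, hg⟩, e a, e b) ∈ (horizontalData S C V e).smul :=
        ⟨a, ha, b, hb, hgb, rfl⟩
      rw [hs] at hmem
      obtain ⟨a', ha', b', hb', h2, h3⟩ := hmem
      rw [he' (hβ a ha) ha' ((hβe a ha).trans (congrArg Prod.fst h3)),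
        he' (hβ b hb) hb' ((hβe b hb).trans (congrArg Prod.snd h3))]
      exact h2

end BaseIso

/-! ### Exhausting a set by boundedly many steps. -/

section Reach
variable {Y : Type u}

/-- The set of points that can be reached from `a` by at most `j` steps of the relation `R`. -/
def reach (R : Y → Y → Prop) (a : Y) : ℕ → Set Y
  | 0 => {a}
  | j + 1 => reach R a j ∪ {y | ∃ z ∈ reach R a j, R z y}

theorem reach_mono (R : Y → Y → Prop) (a : Y) : Monotone (reach R a) :=
  monotone_nat_of_le_succ fun _ => Set.subset_union_left

/-- Pigeonhole: if the sets grew strictly at each of the first `D` steps, the last would have more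
than `D` points. The size bound is needed only up to step `D`, which is what allows the bootstrap in
`IsComponent.base_bounded`. -/
theorem reflTransGen_mem_reach {R : Y → Y → Prop} {a : Y} {D : ℕ}
    (h : ∀ j ≤ D, (reach R a j).Finite ∧ (reach R a j).ncard ≤ D) {y : Y}
    (hy : Relation.ReflTransGen R a y) : y ∈ reach R a D := by
  obtain ⟨j, hj, heq⟩ : ∃ j < D, reach R a (j + 1) = reach R a j := by
    by_contra! hne
    have hcard : ∀ j ≤ D, j + 1 ≤ (reach R a j).ncard := by
      intro j
      induction j with
      | zero => intro _; simp [reach]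
      | succ j ih =>
        intro hj
        have hlt : (reach R a j).ncard < (reach R a (j + 1)).ncard := Set.ncard_lt_ncard
          ((reach_mono R a (Nat.le_succ j)).ssubset_of_ne (hne j (by omega)).symm) (h _ hj).1
        have := ih (by omega)
        omega
    have := hcard D le_rfl
    have := (h D le_rfl).2
    omega
  refine reach_mono R a hj.le ?_
  induction hy with
  | refl => exact reach_mono R a (Nat.zero_le j) rfl
  | tail _ hR ih => rw [← heq]; exact Or.inr ⟨_, ih, hR⟩

end Reach

theorem finite_range_of_factorsThrough {α β : Type*} {δ : Type*} [Finite δ] {f : α → β}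
    {τ : α → δ} (h : ∀ a b, τ a = τ b → f a = f b) : (Set.range f).Finite := by
  have : Function.FactorsThrough f (Set.rangeFactorization τ) :=
    fun a b hab => h a b (congrArg Subtype.val hab)
  refine (Set.finite_range fun d : Set.range τ => f d.2.choose).subset ?_
  rintro _ ⟨a, rfl⟩
  exact ⟨⟨τ a, a, rfl⟩, h _ _ (Exists.choose_spec (p := fun y => τ y = τ a) ⟨a, rfl⟩)⟩

/-! ### Components of pulled back shadows and their bottom levels. -/

section Components
variable {G : Type u} {X : Type v} [Group G] [MulAction G (List X)] {S : Set G}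

theorem iterate_dropLast_eq_take (k : ℕ) (u : List X) :
    List.dropLast^[k] u = u.take (u.length - k) := by
  induction k generalizing u with
  | zero => simp
  | succ k ih =>
    rw [Function.iterate_succ_apply, ih, List.dropLast_eq_take, List.take_take]
    congr 1
    rw [List.length_take]
    omega

theorem IsComponent.mem_of_adj {A C : Set (List X)} (h : IsComponent S A C) {a b : List X}
    (ha : a ∈ C) (hb : b ∈ A) (hab : (skeleton X S).Adj a b) : b ∈ C := by
  obtain ⟨c, rfl⟩ := h
  obtain ⟨a, hac, rfl⟩ := ha
  refine ⟨⟨b, hb⟩, ?_, rfl⟩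
  rw [SimpleGraph.ConnectedComponent.mem_supp_iff] at hac ⊢
  rw [← hac, eq_comm, SimpleGraph.ConnectedComponent.eq]
  exact SimpleGraph.Adj.reachable hab

theorem IsComponent.reflTransGen {A C : Set (List X)} (h : IsComponent S A C) {a b : List X}
    (ha : a ∈ C) (hb : b ∈ C) :
    Relation.ReflTransGen (fun x y => x ∈ A ∧ y ∈ A ∧ (skeleton X S).Adj x y) a b := by
  obtain ⟨c, rfl⟩ := h
  obtain ⟨a, hac, rfl⟩ := ha
  obtain ⟨b, hbc, rfl⟩ := hb
  rw [SimpleGraph.ConnectedComponent.mem_supp_iff] at hac hbc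
  have hr := (SimpleGraph.reachable_iff_reflTransGen a b).1
    (SimpleGraph.ConnectedComponent.exact (hac.trans hbc.symm))
  exact hr.lift Subtype.val fun x y hxy => ⟨x.2, y.2, hxy⟩

theorem adj_cons (x : X) (a : List X) : (skeleton X S).Adj a (x :: a) := by
  rw [skeleton, SimpleGraph.fromRel_adj]
  exact ⟨by simp, Or.inl ⟨.vert a x, rfl, rfl⟩⟩

theorem append_mem_pullback_shadow {k : ℕ} {B : Set (List X)} {b : List X}
    (hb : b ∈ pullback k B) (w : List X) : w ++ b ∈ pullback k (shadow B) := by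
  refine ⟨hb.1.trans (by simp), ?_⟩
  rw [iterate_dropLast_append k w b hb.1]
  exact mem_shadow.2 ⟨w, _, hb.2, rfl⟩

theorem exists_of_mem_pullback_shadow {k : ℕ} {B : Set (List X)} {u : List X}
    (hu : u ∈ pullback k (shadow B)) : ∃ w, ∃ b ∈ pullback k B, u = w ++ b := by
  obtain ⟨hk, h⟩ := hu
  obtain ⟨w, b, hb, he⟩ := mem_shadow.1 h
  have h1 := List.take_append_drop (u.length - k) u
  rw [← iterate_dropLast_eq_take, he, List.append_assoc] at h1
  have hlen : k = (u.drop (u.length - k)).length := by rw [List.length_drop]; omega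
  refine ⟨w, b ++ u.drop (u.length - k), ⟨?_, ?_⟩, h1.symm⟩
  · rw [List.length_append]; omega
  · rw [iterate_dropLast_append k _ _ hlen.le, iterate_dropLast_eq_take, ← hlen]
    simpa using hb

/-- `F` deletes last letters, so the vertical path that adds front letters stays inside the pullback
of the shadow. -/
theorem IsComponent.append_mem_iff {k : ℕ} {B C : Set (List X)}
    (h : IsComponent S (pullback k (shadow B)) C) {b : List X} (hb : b ∈ pullback k B)
    (w : List X) : w ++ b ∈ C ↔ b ∈ C := by
  induction w with
  | nil => rfl
  | cons x w ih =>
    rw [← ih, List.cons_append]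
    exact ⟨fun hx => h.mem_of_adj hx (append_mem_pullback_shadow hb w) (adj_cons x _).symm,
      fun hx => h.mem_of_adj hx (append_mem_pullback_shadow hb (x :: w)) (adj_cons x _)⟩

theorem IsComponent.eq_shadow {k : ℕ} {B C : Set (List X)}
    (h : IsComponent S (pullback k (shadow B)) C) : C = shadow (pullback k B ∩ C) := by
  ext u
  rw [mem_shadow]
  constructor
  · intro hu
    obtain ⟨w, b, hb, rfl⟩ := exists_of_mem_pullback_shadow (h.subset hu)
    exact ⟨w, b, ⟨hb, (h.append_mem_iff hb w).1 hu⟩, rfl⟩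
  · rintro ⟨w, b, ⟨hb, hC⟩, rfl⟩
    exact (h.append_mem_iff hb w).2 hC

theorem length_of_mem_pullback {k l : ℕ} {B : Set (List X)} (hB : ∀ b ∈ B, b.length = l)
    {u : List X} (hu : u ∈ pullback k B) : u.length = l + k := by
  have h1 := hB _ hu.2
  rw [iterate_dropLast_eq_take, List.length_take] at h1
  have := hu.1
  omega

/-- Two vertices of `V` are related when they are equal or joined by a horizontal 1-cell. -/
def horizontalStep (S : Set G) (V : Set (List X)) (a b : List X) : Prop :=
  b ∈ V ∧ ∃ s ∈ insert 1 S, s • a = b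

/-- Project a path in the component to the bottom level by keeping the last `l + k` letters.
Vertical edges collapse, and horizontal edges become horizontal edges labelled by restrictions, or
loops. -/
theorem IsComponent.reflTransGen_horizontalStep (hG : IsSelfSimilar G X)
    (hsymm : ∀ s ∈ S, s⁻¹ ∈ S) (hS : RestrictionClosed X S) {k l : ℕ} {B C : Set (List X)}
    (hB : ∀ b ∈ B, b.length = l) (h : IsComponent S (pullback k (shadow B)) C)
    {a b : List X} (ha : a ∈ pullback k B ∩ C) (hb : b ∈ pullback k B ∩ C) :
    Relation.ReflTransGen (horizontalStep S (pullback k B)) a b := by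
  have key := (h.reflTransGen ha.2 hb.2).lift
    (p := horizontalStep S (pullback k B)) (fun u => u.drop (u.length - (l + k))) ?_
  · simpa [Function.onFun, length_of_mem_pullback hB ha.1,
      length_of_mem_pullback hB hb.1] using key
  · have hproj : ∀ w, ∀ b ∈ pullback k B,
        (w ++ b).drop ((w ++ b).length - (l + k)) = b := by
      intro w b hb
      rw [List.length_append, length_of_mem_pullback hB hb, Nat.add_sub_cancel, List.drop_left]
    rintro x y ⟨hx, hy, hxy⟩
    obtain ⟨w, c, hc, rfl⟩ := exists_of_mem_pullback_shadow hx
    obtain ⟨w', c', hc', rfl⟩ := exists_of_mem_pullback_shadow hy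
    simp only [Function.onFun, hproj _ _ hc, hproj _ _ hc']
    have hlc := length_of_mem_pullback hB hc
    have hlc' := length_of_mem_pullback hB hc'
    refine ⟨hc', ?_⟩
    rcases skeleton_adj_cases hsymm hxy with ⟨s, hs, he⟩ | ⟨x, he⟩ | ⟨x, he⟩
    · obtain ⟨t, ht⟩ := exists_isRestriction hG s w
      have hlen := congrArg List.length he
      simp only [length_smul hG, List.length_append] at hlen
      exact ⟨t, Set.mem_insert_of_mem _ (hS s hs w t ht),
        ((ht.smul_append_eq_iff hG (by omega)).1 he.symm).2⟩
    · refine ⟨1, Set.mem_insert _ _, ?_⟩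
      rw [← List.cons_append] at he
      rw [one_smul, (List.append_inj' he (by omega)).2]
    · refine ⟨1, Set.mem_insert _ _, ?_⟩
      rw [← List.cons_append] at he
      rw [one_smul, (List.append_inj' he (by omega)).2]

theorem exists_smul_of_mem_reach {V : Set (List X)} {a y : List X} (ha : a ∈ V) {j : ℕ}
    (hy : y ∈ reach (horizontalStep S V) a j) : y ∈ V ∧ ∃ g ∈ insert 1 S ^ j, g • a = y := by
  induction j generalizing y with
  | zero => rw [reach, Set.mem_singleton_iff] at hy; subst hy; exact ⟨ha, 1, by simp⟩
  | succ j ih =>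
    rcases hy with hy | ⟨z, hz, hyV, s, hs, rfl⟩
    · obtain ⟨hyV, g, hg, he⟩ := ih hy
      exact ⟨hyV, g, insert_one_pow_subset (Nat.le_succ j) hg, he⟩
    · obtain ⟨-, g, hg, rfl⟩ := ih hz
      refine ⟨hyV, s * g, ?_, mul_smul _ _ _⟩
      rw [pow_succ']
      exact Set.mul_mem_mul hs hg

/-- By the normal form, a point of the ball is `w.take j ++ g • v.drop i` with `i`, `j` and the
length of `g` at most `r`; the number of such parameters does not depend on `v`. -/
theorem exists_horBall_bound [Finite X] (hG : IsSelfSimilar G X) (hfin : S.Finite)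
    (hsymm : ∀ s ∈ S, s⁻¹ ∈ S) (hS : RestrictionClosed X S) (r : ℕ) :
    ∃ D : ℕ, ∀ v : List X, (horBall S v r).Finite ∧ (horBall S v r).ncard ≤ D := by
  let Z : Set (List X × G × ℕ) :=
    {w : List X | w.length ≤ r} ×ˢ ((insert 1 S ^ r : Set G) ×ˢ Set.Iic r)
  have hZ : Z.Finite := (List.finite_length_le X r).prod
    ((finite_insert_one_pow hfin r).prod (Set.finite_Iic r))
  refine ⟨Z.ncard, fun v => ?_⟩
  have hsub : horBall S v r ⊆ (fun z => z.1 ++ z.2.1 • v.drop z.2.2) '' Z := by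
    rintro w ⟨hlen, hd⟩
    obtain ⟨i, j, m, g, hg, hi, hj, h, hij⟩ := exists_normal_form hG hsymm hS v w
    refine ⟨(w.take j, g, i), ⟨?_, insert_one_pow_subset (by omega) hg, ?_⟩, ?_⟩
    · change (w.take j).length ≤ r
      rw [List.length_take]; omega
    · change i ≤ r
      omega
    · change w.take j ++ g • v.drop i = w
      rw [h, List.take_append_drop]
  have himg := hZ.image (fun z : List X × G × ℕ => z.1 ++ z.2.1 • v.drop z.2.2)
  exact ⟨himg.subset hsub, (Set.ncard_le_ncard hsub himg).trans (Set.ncard_image_le hZ)⟩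

/-- A bootstrap: `D` bounds both the number of steps considered and the number of points they can
reach, so `D` steps already exhaust the bottom level. The bound does not involve `k`. -/
theorem IsComponent.base_bounded (hG : IsSelfSimilar G X) (hfin : S.Finite)
    (hsymm : ∀ s ∈ S, s⁻¹ ∈ S) (hS : RestrictionClosed X S) {k l D : ℕ} {B C : Set (List X)}
    (hB : ∀ b ∈ B, b.length = l) (hBfin : B.Finite) (hD : B.ncard * S.ncard ≤ D)
    (hl : ∀ g ∈ insert 1 S ^ D, ∀ v : List X, l ≤ v.length → ∀ h : G, IsRestriction g v h → h ∈ S)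
    (h : IsComponent S (pullback k (shadow B)) C) :
    (pullback k B ∩ C).Finite ∧ (pullback k B ∩ C).ncard ≤ D ∧
      ∀ a ∈ pullback k B ∩ C, ∀ b ∈ pullback k B ∩ C, (skeleton X S).dist a b ≤ D := by
  have key : ∀ a ∈ pullback k B, ∀ j ≤ D, (reach (horizontalStep S (pullback k B)) a j).Finite ∧
      (reach (horizontalStep S (pullback k B)) a j).ncard ≤ D := by
    intro a ha j hj
    -- After at most `D` steps the point is `g • a` with `g` in the ball of radius `D`. Its first
    -- `l` letters lie in `B`, and by `hl` the remaining `k` letters are the image of `a.drop l`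
    -- under an element of `S`.
    have hsub : reach (horizontalStep S (pullback k B)) a j ⊆
        (fun z : List X × G => z.1 ++ z.2 • a.drop l) '' (B ×ˢ S) := by
      intro y hy
      obtain ⟨hyV, g, hg, rfl⟩ := exists_smul_of_mem_reach ha hy
      have hal := length_of_mem_pullback hB ha
      have hlen : (a.take l).length = l := by rw [List.length_take]; omega
      obtain ⟨t, ht⟩ := exists_isRestriction hG g (a.take l)
      refine ⟨(g • a.take l, t),
        ⟨?_, hl g (insert_one_pow_subset hj hg) _ hlen.ge t ht⟩, ?_⟩
      · have := hyV.2
        rwa [iterate_dropLast_smul hG, iterate_dropLast_eq_take, hal, Nat.add_sub_cancel] at this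
      · change g • a.take l ++ t • a.drop l = g • a
        rw [← ht, List.take_append_drop]
    have hfin' := (hBfin.prod hfin)
    have himg := hfin'.image (fun z : List X × G => z.1 ++ z.2 • a.drop l)
    refine ⟨himg.subset hsub, ((Set.ncard_le_ncard hsub himg).trans
      (Set.ncard_image_le hfin')).trans ?_⟩
    rwa [Set.ncard_prod]
  have hreach : ∀ a ∈ pullback k B ∩ C,
      pullback k B ∩ C ⊆ reach (horizontalStep S (pullback k B)) a D := fun a ha b hb =>
    reflTransGen_mem_reach (key a ha.1)
      (h.reflTransGen_horizontalStep hG hsymm hS hB ha hb)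
  refine ⟨?_, ?_, fun a ha b hb => ?_⟩
  · rcases (pullback k B ∩ C).eq_empty_or_nonempty with he | ⟨a, ha⟩
    · rw [he]; exact Set.finite_empty
    · exact (key a ha.1 D le_rfl).1.subset (hreach a ha)
  · rcases (pullback k B ∩ C).eq_empty_or_nonempty with he | ⟨a, ha⟩
    · rw [he]; simp
    · exact (Set.ncard_le_ncard (hreach a ha) (key a ha.1 D le_rfl).1).trans
        (key a ha.1 D le_rfl).2
  · obtain ⟨-, g, hg, rfl⟩ := exists_smul_of_mem_reach ha.1 (hreach a ha hb)
    exact dist_smul_le hg a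

end Components

/-! ### Counting the data. -/

section Finiteness
variable {G : Type u} {X : Type v} [Group G] [MulAction G (List X)] {S : Set G}

theorem exists_injOn_fin {V : Set (List X)} {M : ℕ} (hM : 0 < M) (hV : V.Finite)
    (hc : V.ncard ≤ M) : ∃ e : List X → Fin M, Set.InjOn e V := by
  have : Nonempty (Fin M) := ⟨⟨0, hM⟩⟩
  obtain ⟨e, -, he⟩ := hV.exists_injOn_of_encard_le (t := (Set.univ : Set (Fin M))) (by
    rw [Set.encard_univ, ENat.card_eq_coe_fintype_card, Fintype.card_fin, ← hV.cast_ncard_eq]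
    exact_mod_cast hc)
  exact ⟨e, he⟩

variable {r n : ℕ}

theorem dist_le_of_mem_horBall {v a b : List X} (ha : a ∈ horBall S v r)
    (hb : b ∈ horBall S v r) : (skeleton X S).dist a b ≤ 2 * r := by
  have h1 := ha.2
  have h2 := hb.2
  have h3 := (skeleton_connected X S).dist_triangle (u := a) (v := v) (w := b)
  rw [SimpleGraph.dist_comm] at h1
  omega

namespace ShadowPullback

/-- The finite combinatorial data that determine the isometry types of `F^k : S̃ → S` and of
`F^k : Ũ → U`. -/
def data (P : ShadowPullback X S r n) (C : ℕ) {M : ℕ} (e eB : List X → Fin M) :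
    HorizontalData M (insert 1 S ^ C : Set G) × HorizontalData M (insert 1 S ^ C : Set G) ×
      Set (Fin M × Fin M) :=
  (horizontalData S C P.liftedBase e, horizontalData S C P.base eB,
    {p | ∃ a ∈ P.liftedBase, p = (e a, eB (List.dropLast^[P.k] a))})

theorem comp_eq_shadow (P : ShadowPullback X S r n) : P.comp = shadow P.liftedBase :=
  P.isComponent.eq_shadow

theorem length_of_mem_base (P : ShadowPullback X S r n) {b : List X} (hb : b ∈ P.base) :
    b.length = P.v.length := hb.1

theorem length_of_mem_liftedBase (P : ShadowPullback X S r n) {b : List X}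
    (hb : b ∈ P.liftedBase) : b.length = P.v.length + P.k :=
  length_of_mem_pullback (fun _ hc => P.length_of_mem_base hc) hb.1

theorem nil_notMem_base (P : ShadowPullback X S r n) : [] ∉ P.base := fun h => by
  have h1 := P.length_of_mem_base h
  have h2 := P.level
  rw [List.length_nil] at h1
  omega

theorem nil_notMem_liftedBase (P : ShadowPullback X S r n) : [] ∉ P.liftedBase := fun h => by
  have h1 := P.length_of_mem_liftedBase h
  have h2 := P.level
  rw [List.length_nil] at h1
  omega

/-- The first two components of the data give isomorphisms of the two shadows. The third records
`F^k` on the bottom level in terms of labels, which makes these isomorphisms commute with `F^k`. -/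
theorem isometricallyIsomorphic_of_data_eq (hG : IsSelfSimilar G X) (hsymm : ∀ s ∈ S, s⁻¹ ∈ S)
    (hS : RestrictionClosed X S) {C M : ℕ} (hC1 : 1 ≤ C)
    (hC : ∀ a b : List X, ∃ i j m : ℕ, ∃ g ∈ insert 1 S ^ m, i ≤ a.length ∧ j ≤ b.length ∧
      g • a.drop i = b.drop j ∧ i + j + m = (skeleton X S).dist a b ∧ m ≤ C)
    (P Q : ShadowPullback X S r n) {e eB e' eB' : List X → Fin M}
    (he : Set.InjOn e P.liftedBase) (heB : Set.InjOn eB P.base)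
    (he' : Set.InjOn e' Q.liftedBase) (heB' : Set.InjOn eB' Q.base)
    (hd : ∀ a ∈ P.liftedBase, ∀ b ∈ P.liftedBase, (skeleton X S).dist a b < M)
    (hdB : ∀ a ∈ P.base, ∀ b ∈ P.base, (skeleton X S).dist a b < M)
    (h : P.data C e eB = Q.data C e' eB') :
    IsometricallyIsomorphic (P.shadowMap hG) (Q.shadowMap hG) ∧
      IsometricallyIsomorphic (P.umbraMap hG) (Q.umbraMap hG) := by
  simp only [data, Prod.mk.injEq] at h
  obtain ⟨h1, h2, h3⟩ := h
  obtain ⟨α, α', Hα, hα⟩ := exists_baseIso he he' hd (fun _ ha => P.length_of_mem_liftedBase ha)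
    (fun _ ha => Q.length_of_mem_liftedBase ha) h1
  obtain ⟨β, β', Hβ, hβ⟩ := exists_baseIso heB heB' hdB (fun _ ha => P.length_of_mem_base ha)
    (fun _ ha => Q.length_of_mem_base ha) h2
  have HA := Hα.vertexIso hG hS hC1 hC
  have HB := Hβ.vertexIso hG hS hC1 hC
  have hcomm : ∀ a ∈ P.liftedBase, β (List.dropLast^[P.k] a) = List.dropLast^[Q.k] (α a) := by
    intro a ha
    have hmem : (e a, eB (List.dropLast^[P.k] a)) ∈
        {p | ∃ a ∈ P.liftedBase, p = (e a, eB (List.dropLast^[P.k] a))} := ⟨a, ha, rfl⟩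
    rw [h3] at hmem
    obtain ⟨a', ha', hp⟩ := hmem
    rw [Prod.mk.injEq] at hp
    rw [he' (Hα.mapsTo ha) ha' ((hα a ha).trans hp.1)]
    exact heB' (Hβ.mapsTo ha.1.2) ha'.1.2 ((hβ _ ha.1.2).trans hp.2)
  -- Above the bottom level both `F^k` and the extensions leave the front letters untouched, so
  -- `hcomm` propagates.
  have hext : ∀ u ∈ shadow P.liftedBase,
      extendAbove P.v.length β (List.dropLast^[P.k] u) =
        List.dropLast^[Q.k] (extendAbove (P.v.length + P.k) α u) := by
    intro u hu
    obtain ⟨w, a, ha, rfl⟩ := mem_shadow.1 hu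
    rw [Hα.extend_append ha, iterate_dropLast_append _ _ _ ha.1.1,
      iterate_dropLast_append _ _ _ (Hα.mapsTo ha).1.1, Hβ.extend_append ha.1.2, hcomm a ha]
  have HA' : VertexIso S P.comp Q.comp (extendAbove (P.v.length + P.k) α)
      (extendAbove (Q.v.length + Q.k) α') := by
    rw [P.comp_eq_shadow, Q.comp_eq_shadow]; exact HA
  refine ⟨isometricallyIsomorphic_of_vertexIso HA' HB (fun a ha => hext a ?_)
    (P.mapsTo_shadow hG) (Q.mapsTo_shadow hG), ?_⟩
  · rw [← P.comp_eq_shadow]; exact ha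
  · exact isometricallyIsomorphic_of_vertexIso
      (HA.restrict (fun _ h => h.1) (fun _ h => h.1)
        (HA.mapsTo_umbra hsymm P.nil_notMem_liftedBase)
        (HA.symm.mapsTo_umbra hsymm Q.nil_notMem_liftedBase))
      (HB.restrict (fun _ h => h.1) (fun _ h => h.1)
        (HB.mapsTo_umbra hsymm P.nil_notMem_base) (HB.symm.mapsTo_umbra hsymm Q.nil_notMem_base))
      (fun a ha => hext a ha.1) (P.mapsTo_umbra hG) (Q.mapsTo_umbra hG)

end ShadowPullback

theorem exists_level_finite_isometryTypes [Finite X] (hG : IsSelfSimilar G X) (hfin : S.Finite)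
    (hsymm : ∀ s ∈ S, s⁻¹ ∈ S) (hS : RestrictionClosed X S) (hA : Attracts X S) (r : ℕ) :
    ∃ n : ℕ, (Set.range fun P : ShadowPullback X S r n => isometryType (P.shadowMap hG)).Finite ∧
      (Set.range fun P : ShadowPullback X S r n => isometryType (P.umbraMap hG)).Finite := by
  obtain ⟨C₀, hC₀⟩ := exists_bounded_normal_form hG hfin hsymm hS hA
  obtain ⟨C, hC1, hC⟩ : ∃ C, 1 ≤ C ∧ ∀ a b : List X, ∃ i j m : ℕ, ∃ g ∈ insert 1 S ^ m,
      i ≤ a.length ∧ j ≤ b.length ∧ g • a.drop i = b.drop j ∧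
        i + j + m = (skeleton X S).dist a b ∧ m ≤ C := by
    refine ⟨C₀ + 1, by omega, fun a b => ?_⟩
    obtain ⟨i, j, m, g, hg, hi, hj, h, hd, hm⟩ := hC₀ a b
    exact ⟨i, j, m, g, hg, hi, hj, h, hd, by omega⟩
  obtain ⟨D, hD⟩ := exists_horBall_bound hG hfin hsymm hS r
  -- `D * S.ncard` bounds the number of points in any bottom level; beyond level `n` all elements of
  -- that length restrict into `S`.
  obtain ⟨n, hn⟩ := hA.uniform (finite_insert_one_pow hfin (D * S.ncard))
  have hbdd : ∀ P : ShadowPullback X S r n, P.liftedBase.Finite ∧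
      P.liftedBase.ncard ≤ D * S.ncard ∧ ∀ a ∈ P.liftedBase, ∀ b ∈ P.liftedBase,
        (skeleton X S).dist a b ≤ D * S.ncard := fun P =>
    P.isComponent.base_bounded hG hfin hsymm hS (fun _ hb => P.length_of_mem_base hb)
      (hD P.v).1 (Nat.mul_le_mul_right _ (hD P.v).2)
      (fun g hg v hv => hn g hg v (P.level.le.trans hv))
  -- `M` exceeds the cardinalities and diameters of all bases and lifted bases: `D * S.ncard` serves
  -- both purposes for the lifted ones, `D` and `2 * r` for the balls.
  obtain ⟨M, hM⟩ : ∃ M, M = D * S.ncard + D + 2 * r + 1 := ⟨_, rfl⟩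
  -- The labellings are arbitrary: coincidence of data for the chosen ones suffices, as only
  -- finitely many data exist.
  choose e he using fun P : ShadowPullback X S r n =>
    exists_injOn_fin (M := M) (by omega) (hbdd P).1 (by have := (hbdd P).2.1; omega)
  choose eB heB using fun P : ShadowPullback X S r n =>
    exists_injOn_fin (M := M) (V := P.base) (by omega) (hD P.v).1 ((hD P.v).2.trans (by omega))
  have : Finite ↥(insert 1 S ^ C : Set G) := (finite_insert_one_pow hfin C).to_subtype
  have key : ∀ P Q : ShadowPullback X S r n,
      P.data C (e P) (eB P) = Q.data C (e Q) (eB Q) →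
      IsometricallyIsomorphic (P.shadowMap hG) (Q.shadowMap hG) ∧
        IsometricallyIsomorphic (P.umbraMap hG) (Q.umbraMap hG) := fun P Q h =>
    P.isometricallyIsomorphic_of_data_eq hG hsymm hS hC1 hC Q (he P) (heB P) (he Q) (heB Q)
      (fun a ha b hb => by have := (hbdd P).2.2 a ha b hb; omega)
      (fun a ha b hb => by have := dist_le_of_mem_horBall ha hb; omega) h
  exact ⟨n, finite_range_of_factorsThrough fun P Q h => Quotient.sound (key P Q h).1,
    finite_range_of_factorsThrough fun P Q h => Quotient.sound (key P Q h).2⟩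

end Finiteness

end SelfSim

theorem mainTheorem1 {G : Type*} {X : Type*} [Group G] [Finite X] [MulAction G (List X)]
    [FaithfulSMul G (List X)]
    (hG : SelfSim.IsSelfSimilar G X)
    (htrans : SelfSim.IsLevelTransitive G X)
    (hcontr : SelfSim.IsContracting G X)
    (hrec : SelfSim.IsRecurrent G X)
    (S : Set G) (hfin : S.Finite) (hgen : Subgroup.closure S = ⊤)
    (hsymm : ∀ s ∈ S, s⁻¹ ∈ S)
    (hrestr : SelfSim.RestrictionClosed X S)
    (hnuc : SelfSim.nucleus G X ⊆ S)
    (r : ℕ) (hr : 0 < r) :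
    ∃ n : ℕ,
      (Set.range fun P : SelfSim.ShadowPullback X S r n =>
        SelfSim.isometryType (P.shadowMap hG)).Finite ∧
      (Set.range fun P : SelfSim.ShadowPullback X S r n =>
        SelfSim.isometryType (P.umbraMap hG)).Finite :=
  SelfSim.exists_level_finite_isometryTypes hG hfin hsymm hrestr
    ((SelfSim.attracts_nucleus hcontr).mono hnuc) r
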